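/- Let $R$ be an associative ring with $1$. For a left (right) $R$-module $M$ let $M^*=\mathrm{Hom}_{\mathbb Z}(M,\mathbb Q/\mathbb Z)$ be the dual right (left) $R$-module. All classes of modules are closed under isomorphism. For a class $\mathcal X$ of modules let $\mathcal X^*$ be the class of duals of modules in $\mathcal X$ (up to isomorphism), $\mathrm{Prod}(\mathcal X)$ the closure of $\mathcal X$ under direct products and direct summands, $\mathcal X^+$ its closure under pure submodules, and $\mathrm{Pinj}(\mathcal X)$ the class of pure-injective modules in $\mathcal X$. A class is definable if it is closed under direct products, direct limits and pure submodules. Let $\mathcal S$ be a class of left $R$-modules and $\mathcal P$ a class of right $R$-modules. The pair $(\mathcal S,\mathcal P)$ is an almost dual pair if $\mathcal P=\mathrm{Prod}(\mathcal P)$, $\mathcal P$ is closed under pure-injective hulls, and for every left $R$-module $M$ one has $M\in\mathcal S$ if and only if $M^*\in\mathcal P$. It is a dual pair if moreover $\mathrm{Prod}(\mathcal S^*)=\mathrm{Pinj}(\mathcal P)$. It is a dual pair of definable subcategories if moreover $\mathcal S$ and $\mathcal P$ are definable and are elementary duals of each other, that is, $\mathcal P=(\mathcal S^*)^+$ and $\mathcal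 S=(\mathcal P^*)^+$. The same terms are used with left and right modules interchanged. **Theorem 4.4.** Suppose that $(\mathcal S,\mathcal P)$ is an almost dual pair over $R$. Then the following are equivalent: (i) $\mathcal P^+$ is definable; (ii) $\mathcal P^*\subseteq\mathcal S$; (iii) $(\mathcal P^+)^*\subseteq\mathcal S$; (iv) $\mathcal S$ is definable and $\mathrm{Pinj}(\mathcal P)\subseteq\mathrm{Prod}(\mathcal S^*)$; (v) $\mathcal S$ is definable and every $A\in\mathcal P^+$ is isomorphic to a pure submodule of the dual $M^*$ of some $M\in\mathcal S$; (vi) $\mathcal S$ is definable and $(\mathcal S,\mathcal P)$ is a dual pair; (vii) $(\mathcal S,\mathcal P^+)$ is a dual pair of definable subcategories. Moreover, if (vii) holds, then $(\mathcal P^+,\mathcal S)$ is also a dual pair of definable subcategories. -/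

import Mathlib

open CategoryTheory MulOpposite

universe u

namespace DualPairs

/-! Left modules over a ring `R` are objects of `ModuleCat R`; right `R`-modules are objects of
`ModuleCat Rᵐᵒᵖ`, the right action being `x · r = op r • x`.  Classes of modules are
`ObjectProperty`s.  -/

section Purity

variable {R : Type u} [Ring R]

/-- A pure embedding: an injective linear map `f : A → B` such that every finite system of
linear equations with constants from `A` that is solvable in `B` is solvable in `A`. -/
def IsPureEmbedding {A B : ModuleCat.{u} R} (f : A →ₗ[R] B) : Prop :=
  Function.Injective f ∧
    ∀ (m n : ℕ) (r : Matrix (Fin m) (Fin n) R) (a : Fin m → A),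
      (∃ y : Fin n → B, ∀ i, ∑ j, r i j • y j = f (a i)) →
        ∃ x : Fin n → A, ∀ i, ∑ j, r i j • x j = a i

/-- A module is pure-injective if it is injective with respect to pure embeddings. -/
def IsPureInjective (N : ModuleCat.{u} R) : Prop :=
  ∀ ⦃A B : ModuleCat.{u} R⦄ (f : A →ₗ[R] B), IsPureEmbedding f →
    ∀ g : A →ₗ[R] N, ∃ h : B →ₗ[R] N, h ∘ₗ f = g

/-- `i : M → H` is a pure-injective hull (pure-injective envelope) of `M`: a pure embedding into
a pure-injective module such that every endomorphism of `H` over `M` is an automorphism. -/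
structure IsPureInjectiveHull {M H : ModuleCat.{u} R} (i : M →ₗ[R] H) : Prop where
  isPureEmbedding : IsPureEmbedding i
  isPureInjective : IsPureInjective H
  bijective_of_comp_eq : ∀ h : H →ₗ[R] H, h ∘ₗ i = i → Function.Bijective h

/-- `A` is (isomorphic to) a direct summand of `B`. -/
def IsDirectSummand (A B : ModuleCat.{u} R) : Prop :=
  ∃ (i : A →ₗ[R] B) (p : B →ₗ[R] A), p ∘ₗ i = LinearMap.id

end Purity

section Classes

variable {R : Type u} [Ring R]

/-- `Prod(X)`: the closure of `X` under direct products and direct summands. -/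
inductive ProdClosure (X : ObjectProperty (ModuleCat.{u} R)) : ObjectProperty (ModuleCat.{u} R)
  | of (M : ModuleCat.{u} R) (hM : X M) : ProdClosure X M
  | prod (I : Type u) (M : I → ModuleCat.{u} R) (hM : ∀ i, ProdClosure X (M i)) :
      ProdClosure X (ModuleCat.of R (∀ i, M i))
  | summand (A B : ModuleCat.{u} R) (hAB : IsDirectSummand A B) (hB : ProdClosure X B) :
      ProdClosure X A

/-- `X⁺`: the closure of `X` under pure submodules. -/
def PureClosure (X : ObjectProperty (ModuleCat.{u} R)) : ObjectProperty (ModuleCat.{u} R) :=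
  fun A => ∃ (B : ModuleCat.{u} R) (f : A →ₗ[R] B), X B ∧ IsPureEmbedding f

/-- `Pinj(X)`: the pure-injective modules in `X`. -/
def Pinj (X : ObjectProperty (ModuleCat.{u} R)) : ObjectProperty (ModuleCat.{u} R) :=
  fun M => X M ∧ IsPureInjective M

/-- `X` is closed under pure-injective hulls. -/
def ClosedUnderHulls (X : ObjectProperty (ModuleCat.{u} R)) : Prop :=
  ∀ ⦃M H : ModuleCat.{u} R⦄ (i : M →ₗ[R] H), IsPureInjectiveHull i → X M → X H

/-- A definable subcategory: a class of modules (closed under isomorphism) that is closed under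
direct products, direct limits and pure submodules. -/
structure IsDefinable (X : ObjectProperty (ModuleCat.{u} R)) : Prop where
  iso : ∀ ⦃A B : ModuleCat.{u} R⦄, (A ≃ₗ[R] B) → X A → X B
  prod : ∀ (I : Type u) (M : I → ModuleCat.{u} R), (∀ i, X (M i)) →
    X (ModuleCat.of R (∀ i, M i))
  directLimit : ∀ (I : Type u) [Preorder I] [IsDirectedOrder I] [Nonempty I] [DecidableEq I]
    (G : I → ModuleCat.{u} R) (f : ∀ i j, i ≤ j → G i →ₗ[R] G j)
    [DirectedSystem (fun i => G i) fun i j h => f i j h],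
    (∀ i, X (G i)) → X (ModuleCat.of R (Module.DirectLimit (fun i => G i) f))
  pure : ∀ ⦃A B : ModuleCat.{u} R⦄ (f : A →ₗ[R] B), IsPureEmbedding f → X B → X A

end Classes

section Dual

variable (R : Type u) [Ring R]

/-- The right `R`-module structure on `Hom_ℤ(M, ℚ/ℤ)` for a left module `M`:
`(f · r) x = f (r • x)`. -/
abbrev leftDualModule (M : ModuleCat.{u} R) : Module Rᵐᵒᵖ (CharacterModule M) where
  smul r f := AddMonoidHom.comp f (Module.toAddMonoidEnd R M r.unop)
  one_smul f := CharacterModule.ext _ fun x => congrArg f (one_smul R x)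
  mul_smul r s f := CharacterModule.ext _ fun x => congrArg f (mul_smul s.unop r.unop x)
  smul_zero _ := rfl
  smul_add _ _ _ := rfl
  add_smul r s f := CharacterModule.ext _ fun x =>
    (congrArg f (add_smul r.unop s.unop x)).trans (map_add f _ _)
  zero_smul f := CharacterModule.ext _ fun x => (congrArg f (zero_smul R x)).trans (map_zero f)

/-- The left `R`-module structure on `Hom_ℤ(N, ℚ/ℤ)` for a right module `N`:
`(r • f) x = f (x · r)`. -/
abbrev rightDualModule (N : ModuleCat.{u} Rᵐᵒᵖ) : Module R (CharacterModule N) where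
  smul r f := AddMonoidHom.comp f (Module.toAddMonoidEnd Rᵐᵒᵖ N (op r))
  one_smul f := CharacterModule.ext _ fun x => congrArg f (one_smul Rᵐᵒᵖ x)
  mul_smul r s f := CharacterModule.ext _ fun x => congrArg f (mul_smul (op s) (op r) x)
  smul_zero _ := rfl
  smul_add _ _ _ := rfl
  add_smul r s f := CharacterModule.ext _ fun x =>
    (congrArg f (add_smul (op r) (op s) x)).trans (map_add f _ _)
  zero_smul f := CharacterModule.ext _ fun x => (congrArg f (zero_smul Rᵐᵒᵖ x)).trans (map_zero f)

/-- The dual `M* = Hom_ℤ(M, ℚ/ℤ)`, a right module, of a left module `M`. -/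
def leftDual (M : ModuleCat.{u} R) : ModuleCat.{u} Rᵐᵒᵖ :=
  letI := leftDualModule R M
  ModuleCat.of Rᵐᵒᵖ (CharacterModule M)

/-- The dual `N* = Hom_ℤ(N, ℚ/ℤ)`, a left module, of a right module `N`. -/
def rightDual (N : ModuleCat.{u} Rᵐᵒᵖ) : ModuleCat.{u} R :=
  letI := rightDualModule R N
  ModuleCat.of R (CharacterModule N)

end Dual

section Pairs

variable {A B : Type u} [Ring A] [Ring B]

/-! The following notions are used twice, with `d` the duality `leftDual R` from left to right
modules and with `d` the duality `rightDual R` from right to left modules. -/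

/-- `X* = {M* : M ∈ X}`, closed under isomorphism. -/
def dualClass (d : ModuleCat.{u} A → ModuleCat.{u} B) (X : ObjectProperty (ModuleCat.{u} A)) :
    ObjectProperty (ModuleCat.{u} B) :=
  fun N => ∃ M, X M ∧ Nonempty (N ≃ₗ[B] d M)

/-- `(S, P)` is an almost dual pair with respect to the duality `d`. -/
structure IsAlmostDualPair (d : ModuleCat.{u} A → ModuleCat.{u} B)
    (S : ObjectProperty (ModuleCat.{u} A)) (P : ObjectProperty (ModuleCat.{u} B)) : Prop where
  eq_prodClosure : P = ProdClosure P
  closedUnderHulls : ClosedUnderHulls P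
  mem_iff : ∀ M : ModuleCat.{u} A, S M ↔ P (d M)

/-- `(S, P)` is a dual pair: an almost dual pair with `Prod(S*) = Pinj(P)`. -/
structure IsDualPair (d : ModuleCat.{u} A → ModuleCat.{u} B)
    (S : ObjectProperty (ModuleCat.{u} A)) (P : ObjectProperty (ModuleCat.{u} B)) : Prop
    extends IsAlmostDualPair d S P where
  prodClosure_dualClass : ProdClosure (dualClass d S) = Pinj P

/-- `(S, P)` is a dual pair of definable subcategories: it is a dual pair, both classes are
definable, and they are the elementary duals `P = (S*)⁺`, `S = (P*)⁺` of each other.  Here `d'` is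
the duality in the direction opposite to `d`. -/
structure IsDefinableDualPair (d : ModuleCat.{u} A → ModuleCat.{u} B)
    (d' : ModuleCat.{u} B → ModuleCat.{u} A)
    (S : ObjectProperty (ModuleCat.{u} A)) (P : ObjectProperty (ModuleCat.{u} B)) : Prop
    extends IsDualPair d S P where
  definable_left : IsDefinable S
  definable_right : IsDefinable P
  right_eq : P = PureClosure (dualClass d S)
  left_eq : S = PureClosure (dualClass d' P)

end Pairs

end DualPairs

open DualPairs

/-!
Write `M*` for the dual of a module. The argument rests on four facts about duality and purity.

* For a pure embedding `M → N`, restriction `N* → M*` is a split epimorphism, duals are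
  pure-injective, and `M` is pure in `M**`. Hence an almost dual pair `(S, P)` has `S` closed under
  pure submodules, and a pure-injective module of `P⁺` lies in `P`. The splitting
  (`IsPureEmbedding.exists_character_section`) is obtained without tensor products. Purity provides
  a family of functions `N → M` that are asymptotically linear and asymptotically retractions along
  some filter, and a `ℚ/ℤ`-valued generalized limit turns it into a map `M* → N*`.
* The same device, applied to representatives in a directed system, shows that the dual of a direct
  limit is a direct summand of the product of the duals.
* A definable class contains `M**` together with `M` (`IsDefinable.bidual`). A system of linear
  equations that is unsolvable in `M**` stays unsolvable in a suitable reduced power of `M`, to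
  which `M**` maps linearly; so `M**` is pure in a product of reduced powers of `M`, and these are
  direct limits of powers of `M`.
* Pure-injective hulls exist (`exists_isPureInjectiveHull`). A module `M` is pure in the compact
  module `E = Hom(M*, ℝ/ℤ)`. The endomorphisms of `E` over `M` form a compact semigroup with
  continuous right translations, and by the Ellis argument it has an idempotent `e` in a minimal
  left ideal. All endomorphisms of `eE` over `M` are then bijective, so `eE` is a hull.

Given these, all conditions are compared with `P* ⊆ S`. If it holds, then `N ∈ P⁺` if and only if
`N* ∈ S`, and both `S` and `P⁺` are definable; for products in `S` one uses that `∏ Mᵢ` is pure in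
`(⨁ Mᵢ*)*` and `⨁ Mᵢ*` is pure in `∏ Mᵢ*`. Two definable classes that detect each other through
duals form a dual pair in either direction (`isDefinableDualPair_of_mem_iff`). Conversely, `P* ⊆ S`
follows from definability of `P⁺` by passing to biduals, and from the conditions on `S` by taking a
hull of a module in `P`, which is a summand of some `M*` with `M ∈ S`, and dualizing once more.
-/

namespace DualPairs

/-! ### Generalized limits of characters along a filter -/

section Limits

/-- For a proper filter `l` on `X` there is an additive "limit" `(X → ℚ/ℤ) → ℚ/ℤ` that sends
eventually constant functions to their eventual value. The constants embed into the germs along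
`l`, and this embedding splits because `ℚ/ℤ` is an injective group. -/
theorem exists_generalizedLimit {X : Type*} (l : Filter X) [l.NeBot] :
    ∃ Λ : (X → AddCircle (1 : ℚ)) →+ AddCircle (1 : ℚ),
      ∀ (v : X → AddCircle (1 : ℚ)) (c : AddCircle (1 : ℚ)), (∀ᶠ x in l, v x = c) → Λ v = c := by
  let κ : AddCircle (1 : ℚ) →+ l.Germ (AddCircle (1 : ℚ)) :=
    { toFun := fun c => ↑c, map_zero' := rfl, map_add' := fun _ _ => rfl }
  have hκ : Function.Injective κ := fun a b h => Filter.Germ.const_inj.1 h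
  obtain ⟨Λ, hΛ⟩ := (Module.Baer.of_divisible
    (AddCircle (1 : ℚ))).extension_property_addMonoidHom κ hκ (AddMonoidHom.id _)
  refine ⟨Λ.comp ⟨⟨fun v => (v : l.Germ (AddCircle (1 : ℚ))), rfl⟩, fun _ _ => rfl⟩,
    fun v c h => ?_⟩
  have h1 : (v : l.Germ (AddCircle (1 : ℚ))) = κ c := Filter.Germ.coe_eq.2 h
  exact (congrArg Λ h1).trans (DFunLike.congr_fun hΛ c)

/-- If any finitely many of the sets `s i` have a common point, then they all belong to some
proper filter. -/
theorem exists_neBot_filter_forall_mem {X ι : Type*} (s : ι → Set X)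
    (h : ∀ F : Finset ι, ∃ x, ∀ i ∈ F, x ∈ s i) :
    ∃ l : Filter X, l.NeBot ∧ ∀ i, s i ∈ l := by
  classical
  choose x hx using h
  refine ⟨Filter.map x Filter.atTop, inferInstance, fun i => ?_⟩
  exact Filter.mem_map.2 ((Filter.eventually_ge_atTop {i}).mono fun F hF =>
    hx F i (hF (Finset.mem_singleton_self i)))

end Limits

/-! ### Asymptotically linear families -/

section Asymptotic

variable {R : Type*} [Ring R] {B : Type*} [AddCommGroup B] [Module R B]

/-- A family of functions `ρ x : B → G x` is asymptotically linear along `l` if each instance of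
additivity and of `R`-homogeneity holds for eventually all `x`; it thus represents a linear map from
`B` to the reduced product of the `G x`. -/
structure IsAsymptoticallyLinear (R : Type*) [Ring R] {B : Type*} [AddCommGroup B] [Module R B]
    {X : Type*} (l : Filter X) {G : X → Type*} [∀ x, AddCommGroup (G x)]
    [∀ x, Module R (G x)] (ρ : ∀ x, B → G x) : Prop where
  add : ∀ b b', ∀ᶠ x in l, ρ x (b + b') = ρ x b + ρ x b'
  smul : ∀ (r : R) b, ∀ᶠ x in l, ρ x (r • b) = r • ρ x b

/-- Restriction of characters along an additive map. -/
def charComp {A B : Type*} [AddCommGroup A] [AddCommGroup B] (f : A →+ B) :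
    CharacterModule B →+ CharacterModule A where
  toFun χ := AddMonoidHom.comp χ f
  map_zero' := rfl
  map_add' _ _ := rfl

@[simp] theorem charComp_apply {A B : Type*} [AddCommGroup A] [AddCommGroup B] (f : A →+ B)
    (χ : CharacterModule B) (a : A) : charComp f χ a = χ (f a) := rfl

/-- The action `χ ↦ χ ∘ r` of a scalar `r` on characters, before it is made into a module
structure over an opposite ring. -/
def charScale (r : R) : CharacterModule B →+ CharacterModule B :=
  charComp (DistribSMul.toAddMonoidHom B r)

@[simp] theorem charScale_apply (r : R) (χ : CharacterModule B) (b : B) :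
    charScale r χ b = χ (r • b) := rfl

/-- Evaluation of characters at an element. -/
def charEval {A : Type*} [AddCommGroup A] (a : A) : CharacterModule A →+ AddCircle (1 : ℚ) where
  toFun χ := χ a
  map_zero' := rfl
  map_add' _ _ := rfl

@[simp] theorem charEval_apply {A : Type*} [AddCommGroup A] (a : A) (χ : CharacterModule A) :
    charEval a χ = χ a := rfl

theorem character_sum_apply {A J : Type*} [AddCommGroup A] (s : Finset J)
    (g : J → CharacterModule A) (a : A) : (∑ i ∈ s, g i) a = ∑ i ∈ s, g i a :=
  map_sum (charEval a) g s

/-- An asymptotically linear family `ρ x : B → G x` induces a map from families of characters of the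
`G x` to characters of `B`, namely the generalized limit of the `φ x ∘ ρ x`. -/
theorem IsAsymptoticallyLinear.exists_dualMap {X : Type*} {l : Filter X} [l.NeBot] {G : X → Type*}
    [∀ x, AddCommGroup (G x)] [∀ x, Module R (G x)] {ρ : ∀ x, B → G x}
    (hρ : IsAsymptoticallyLinear R l ρ) :
    ∃ Γ : (∀ x, CharacterModule (G x)) →+ CharacterModule B,
      (∀ (φ : ∀ x, CharacterModule (G x)) (r : R),
        Γ (fun x => charScale r (φ x)) = charScale r (Γ φ)) ∧
      ∀ φ b c, (∀ᶠ x in l, φ x (ρ x b) = c) → Γ φ b = c := by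
  obtain ⟨Λ, hΛ⟩ := exists_generalizedLimit l
  have hΛ' : ∀ v w : X → AddCircle (1 : ℚ), (∀ᶠ x in l, v x = w x) → Λ v = Λ w := by
    intro v w h
    rw [← sub_eq_zero, ← map_sub]
    exact hΛ _ _ (h.mono fun x hx => sub_eq_zero.2 hx)
  refine ⟨AddMonoidHom.mk' (fun φ => (AddMonoidHom.mk' (fun b => Λ fun x => φ x (ρ x b)) ?_ :
    B →+ AddCircle (1 : ℚ))) ?_, ?_, ?_⟩
  · intro b b'
    rw [← map_add]
    exact hΛ' _ _ ((hρ.add b b').mono fun x hx => by simp [hx])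
  · intro φ ψ
    refine CharacterModule.ext _ fun b => ?_
    exact map_add Λ (fun x => φ x (ρ x b)) (fun x => ψ x (ρ x b))
  · intro φ r
    refine CharacterModule.ext _ fun b => ?_
    exact hΛ' _ _ ((hρ.smul r b).mono fun x hx => by simp [hx])
  · intro φ b c h
    exact hΛ _ _ h

/-- A direct limit maps asymptotically linearly to the members of the directed system: a
representative of an element is pushed forward along the transition maps. -/
theorem exists_isAsymptoticallyLinear_directLimit {I : Type*} [Preorder I] [IsDirectedOrder I]
    [Nonempty I] [DecidableEq I] (G : I → Type*) [∀ i, AddCommGroup (G i)] [∀ i, Module R (G i)]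
    (f : ∀ i j, i ≤ j → G i →ₗ[R] G j) [DirectedSystem G fun i j h => f i j h] :
    ∃ ρ : ∀ j, Module.DirectLimit G f → G j, IsAsymptoticallyLinear R Filter.atTop ρ ∧
      ∀ i x, ∀ᶠ j in Filter.atTop, ∃ h : i ≤ j, ρ j (Module.DirectLimit.of R I G f i x) =
        f i j h x := by
  classical
  choose i₀ x₀ hx₀ using fun z : Module.DirectLimit G f => Module.DirectLimit.exists_of z
  let ρ : ∀ j, Module.DirectLimit G f → G j :=
    fun j z => if h : i₀ z ≤ j then f (i₀ z) j h (x₀ z) else 0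
  have key : ∀ i x, ∀ᶠ j in Filter.atTop, ∃ h : i ≤ j,
      ρ j (Module.DirectLimit.of R I G f i x) = f i j h x := by
    intro i x
    set z := Module.DirectLimit.of R I G f i x with hz
    obtain ⟨k, hk₁, hk₂⟩ := exists_ge_ge (i₀ z) i
    have h1 : Module.DirectLimit.of R I G f k (f _ k hk₁ (x₀ z)) =
        Module.DirectLimit.of R I G f k (f _ k hk₂ x) := by
      rw [Module.DirectLimit.of_f, Module.DirectLimit.of_f, hx₀]
    obtain ⟨m, hkm, hm⟩ := Module.DirectLimit.exists_eq_of_of_eq h1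
    filter_upwards [Filter.eventually_ge_atTop m] with j hj
    refine ⟨hk₂.trans (hkm.trans hj), ?_⟩
    have h2 := congrArg (f m j hj) hm
    have hmap : ∀ (a b c : I) (hab : a ≤ b) (hbc : b ≤ c) (w : G a),
        f b c hbc (f a b hab w) = f a c (hab.trans hbc) w :=
      fun a b c hab hbc w => DirectedSystem.map_map' (f := fun i j h => f i j h) hab hbc w
    rw [hmap, hmap, hmap, hmap] at h2
    simp only [ρ]
    rw [dif_pos (hk₁.trans (hkm.trans hj))]
    exact h2
  refine ⟨ρ, ⟨fun b b' => ?_, fun r b => ?_⟩, key⟩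
  · obtain ⟨i, x, y, rfl, rfl⟩ := Module.DirectLimit.exists_of₂ b b'
    rw [← map_add]
    filter_upwards [key i x, key i y, key i (x + y)] with j h1 h2 h3
    obtain ⟨h, h1⟩ := h1
    obtain ⟨_, h2⟩ := h2
    obtain ⟨_, h3⟩ := h3
    rw [h1, h2, h3, map_add]
  · obtain ⟨i, x, rfl⟩ := Module.DirectLimit.exists_of b
    rw [← map_smul]
    filter_upwards [key i x, key i (r • x)] with j h1 h2
    obtain ⟨h, h1⟩ := h1
    obtain ⟨_, h2⟩ := h2
    rw [h1, h2, map_smul]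

end Asymptotic

/-! ### Pure embeddings -/

section Pure

variable {R : Type u} [Ring R]

/-- The matrix system in the definition of purity may be indexed by arbitrary finite types. -/
theorem IsPureEmbedding.exists_solution {A B : ModuleCat.{u} R} {f : A →ₗ[R] B}
    (hf : IsPureEmbedding f) {ι κ : Type*} [Fintype ι] [Fintype κ] (r : ι → κ → R) (a : ι → A)
    (y : κ → B) (hy : ∀ i, ∑ j, r i j • y j = f (a i)) :
    ∃ x : κ → A, ∀ i, ∑ j, r i j • x j = a i := by
  let eι := Fintype.equivFin ι
  let eκ := Fintype.equivFin κ
  obtain ⟨x, hx⟩ := hf.2 _ _ (fun i j => r (eι.symm i) (eκ.symm j)) (fun i => a (eι.symm i))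
    ⟨fun j => y (eκ.symm j), fun i => by
      rw [← hy]; exact Equiv.sum_comp eκ.symm fun j => r (eι.symm i) j • y j⟩
  refine ⟨fun j => x (eκ j), fun i => ?_⟩
  have := hx (eι i)
  simp only [Equiv.symm_apply_apply] at this
  rw [← this, ← Equiv.sum_comp eκ]
  simp

theorem IsPureEmbedding.comp {A B C : ModuleCat.{u} R} {g : B →ₗ[R] C} {f : A →ₗ[R] B}
    (hg : IsPureEmbedding g) (hf : IsPureEmbedding f) : IsPureEmbedding (g ∘ₗ f) :=
  ⟨hg.1.comp hf.1, fun m n r a ⟨y, hy⟩ => hf.2 m n r a (hg.2 m n r _ ⟨y, hy⟩)⟩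

theorem IsPureEmbedding.of_comp {A B C : ModuleCat.{u} R} {g : B →ₗ[R] C} {f : A →ₗ[R] B}
    (h : IsPureEmbedding (g ∘ₗ f)) : IsPureEmbedding f :=
  ⟨Function.Injective.of_comp (f := g) h.1, fun m n r a ⟨y, hy⟩ => h.2 m n r a
    ⟨fun j => g (y j), fun i => by simpa using congrArg g (hy i)⟩⟩

theorem isPureEmbedding_of_comp_eq_id {A B : ModuleCat.{u} R} {i : A →ₗ[R] B} {p : B →ₗ[R] A}
    (h : p ∘ₗ i = LinearMap.id) : IsPureEmbedding i := by
  have hp : ∀ a, p (i a) = a := LinearMap.congr_fun h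
  refine ⟨Function.LeftInverse.injective hp, fun m n r a ⟨y, hy⟩ => ⟨fun j => p (y j), fun k => ?_⟩⟩
  rw [← hp (a k), ← hy]
  simp

theorem IsDirectSummand.exists_isPureEmbedding {A B : ModuleCat.{u} R} (h : IsDirectSummand A B) :
    ∃ f : A →ₗ[R] B, IsPureEmbedding f := by
  obtain ⟨i, p, h⟩ := h
  exact ⟨i, isPureEmbedding_of_comp_eq_id h⟩

theorem IsDefinable.isDirectSummand {X : ObjectProperty (ModuleCat.{u} R)} (hX : IsDefinable X)
    {M N : ModuleCat.{u} R} (h : IsDirectSummand M N) (hN : X N) : X M := by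
  obtain ⟨f, hf⟩ := h.exists_isPureEmbedding
  exact hX.pure f hf hN

theorem isDirectSummand_of_linearEquiv {A B : ModuleCat.{u} R} (e : A ≃ₗ[R] B) :
    IsDirectSummand A B :=
  ⟨e, e.symm, by ext; simp⟩

theorem IsDirectSummand.trans {A B C : ModuleCat.{u} R} (h : IsDirectSummand A B)
    (h' : IsDirectSummand B C) : IsDirectSummand A C := by
  obtain ⟨i, p, h⟩ := h
  obtain ⟨i', p', h'⟩ := h'
  refine ⟨i' ∘ₗ i, p ∘ₗ p', ?_⟩
  rw [LinearMap.comp_assoc, ← LinearMap.comp_assoc i, h', LinearMap.id_comp, h]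

theorem IsDirectSummand.pi {I : Type u} {M N : I → ModuleCat.{u} R}
    (h : ∀ i, IsDirectSummand (M i) (N i)) :
    IsDirectSummand (ModuleCat.of R (∀ i, M i)) (ModuleCat.of R (∀ i, N i)) := by
  choose j p h using h
  refine ⟨LinearMap.pi fun i => j i ∘ₗ LinearMap.proj i,
    LinearMap.pi fun i => p i ∘ₗ LinearMap.proj i, LinearMap.ext fun x => funext fun i => ?_⟩
  exact LinearMap.congr_fun (h i) (x i)

theorem IsPureEmbedding.pi {I : Type u} {M N : I → ModuleCat.{u} R} {f : ∀ i, M i →ₗ[R] N i}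
    (h : ∀ i, IsPureEmbedding (f i)) :
    IsPureEmbedding (A := ModuleCat.of R (∀ i, M i)) (B := ModuleCat.of R (∀ i, N i))
      (LinearMap.pi fun i => f i ∘ₗ LinearMap.proj i) := by
  refine ⟨fun x y hxy => funext fun i => (h i).1 (congrFun hxy i), fun m n r a ⟨y, hy⟩ => ?_⟩
  have hy' : ∀ i k, ∑ j, r k j • y j i = f i (a k i) := fun i k => by
    have := congrFun (hy k) i
    simpa [Finset.sum_apply] using this
  choose x hx using fun i => (h i).2 m n r (fun k => a k i) ⟨fun j => y j i, hy' i⟩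
  refine ⟨fun j i => x i j, fun k => funext fun i => ?_⟩
  rw [← hx i k]
  simp [Finset.sum_apply]

/-- The direct sum is pure in the direct product: a solution of a system with constants in the
direct sum can be truncated to the finitely many indices where some constant is nonzero. -/
theorem isPureEmbedding_dfinsupp {I : Type u} (M : I → ModuleCat.{u} R) :
    IsPureEmbedding (A := ModuleCat.of R (Π₀ i, M i)) (B := ModuleCat.of R (∀ i, M i))
      (DFinsupp.coeFnLinearMap R) := by
  classical
  refine ⟨DFunLike.coe_injective, fun m n r a ⟨y, hy⟩ => ?_⟩
  replace hy : ∀ k, ∑ j, r k j • y j = (a k : Π₀ i, M i) := hy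
  let s : Finset I := Finset.univ.biUnion fun k => (a k : Π₀ i, M i).support
  refine ⟨fun j => (DFinsupp.mk s fun i => y j i : Π₀ i, M i), fun k => ?_⟩
  refine DFinsupp.ext (β := fun i => M i) fun i => ?_
  change DFinsupp.lapply (R := R) (M := fun i => M i) i (∑ j, r k j • _) = _
  simp only [map_sum, map_smul, DFinsupp.lapply_apply, DFinsupp.mk_apply]
  by_cases hi : i ∈ s
  · have := congrFun (hy k) i
    simpa [hi, Finset.sum_apply] using this
  · simp only [hi, dite_false, smul_zero, Finset.sum_const_zero]
    have : i ∉ (a k : Π₀ i, M i).support := fun h =>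
      hi (Finset.mem_biUnion.2 ⟨k, Finset.mem_univ _, h⟩)
    exact (DFinsupp.notMem_support_iff.1 this).symm

/-- Along a pure embedding `A → B`, finitely many linear relations between elements of `B` and
elements of `A` can be reflected into `A`. -/
theorem IsPureEmbedding.exists_partial_retraction {A B : ModuleCat.{u} R} {f : A →ₗ[R] B}
    (hf : IsPureEmbedding f) (C : Finset ((B →₀ R) × A))
    (hC : ∀ c ∈ C, Finsupp.linearCombination R id c.1 = f c.2) :
    ∃ ρ : B → A, ∀ c ∈ C, Finsupp.linearCombination R ρ c.1 = c.2 := by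
  classical
  let V : Finset B := C.biUnion fun c => c.1.support
  have hsum : ∀ (M : ModuleCat.{u} R) (v : B → M) (c : C),
      Finsupp.linearCombination R v c.1.1 = ∑ b : V, c.1.1 b • v b := by
    intro M v c
    rw [Finsupp.linearCombination_apply, Finsupp.sum_of_support_subset _
      (Finset.subset_biUnion_of_mem (fun c : (B →₀ R) × A => c.1.support) c.2) _ (by simp)]
    exact (Finset.sum_coe_sort V fun b => c.1.1 b • v b).symm
  obtain ⟨x, hx⟩ := hf.exists_solution (fun (c : C) (b : V) => c.1.1 b) (fun c => c.1.2)
    (fun b => (b : B)) fun c => (hsum B id c).symm.trans (hC c.1 c.2)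
  refine ⟨fun b => if h : b ∈ V then x ⟨b, h⟩ else 0, fun c hc => ?_⟩
  rw [hsum A _ ⟨c, hc⟩]
  simpa using hx ⟨c, hc⟩

/-- A pure embedding has an asymptotically linear family of asymptotic retractions. -/
theorem IsPureEmbedding.exists_isAsymptoticallyLinear {A B : ModuleCat.{u} R} {f : A →ₗ[R] B}
    (hf : IsPureEmbedding f) :
    ∃ l : Filter (B → A), l.NeBot ∧
      IsAsymptoticallyLinear R l (G := fun _ => A) (fun ρ : B → A => ρ) ∧
      ∀ a, ∀ᶠ ρ in l, ρ (f a) = a := by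
  classical
  obtain ⟨l, hl, h⟩ := exists_neBot_filter_forall_mem
    (fun c : {c : (B →₀ R) × A // Finsupp.linearCombination R id c.1 = f c.2} =>
      {ρ : B → A | Finsupp.linearCombination R ρ c.1.1 = c.1.2}) fun F => by
    obtain ⟨ρ, hρ⟩ := hf.exists_partial_retraction (F.image Subtype.val) (by
      intro c hc
      obtain ⟨c, -, rfl⟩ := Finset.mem_image.1 hc
      exact c.2)
    exact ⟨ρ, fun c hc => hρ c.1 (Finset.mem_image_of_mem _ hc)⟩
  refine ⟨l, hl, ⟨fun b b' => ?_, fun r b => ?_⟩, fun a => ?_⟩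
  · filter_upwards [h ⟨(Finsupp.single (b + b') 1 - Finsupp.single b 1 - Finsupp.single b' 1, 0),
      by simp⟩] with ρ hρ
    simpa [sub_sub, sub_eq_zero] using hρ
  · filter_upwards [h ⟨(Finsupp.single (r • b) 1 - Finsupp.single b r, 0), by simp⟩] with ρ hρ
    simpa [sub_eq_zero] using hρ
  · filter_upwards [h ⟨(Finsupp.single (f a) 1, a), by simp⟩] with ρ hρ
    simpa using hρ

/-- Restriction of characters along a pure embedding has a section compatible with scalars. -/
theorem IsPureEmbedding.exists_character_section {A B : ModuleCat.{u} R} {f : A →ₗ[R] B}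
    (hf : IsPureEmbedding f) :
    ∃ Γ : CharacterModule A →+ CharacterModule B,
      (∀ φ (r : R), Γ (charScale r φ) = charScale r (Γ φ)) ∧ ∀ φ a, Γ φ (f a) = φ a := by
  obtain ⟨l, hl, hlin, hret⟩ := hf.exists_isAsymptoticallyLinear
  obtain ⟨Γ, h1, h2⟩ := hlin.exists_dualMap
  refine ⟨Γ.comp ⟨⟨fun φ _ => φ, rfl⟩, fun _ _ => rfl⟩, fun φ r => h1 _ r, fun φ a => ?_⟩
  exact h2 _ _ _ ((hret a).mono fun ρ hρ => congrArg φ hρ)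

theorem IsPureInjective.of_isDirectSummand {A B : ModuleCat.{u} R} (hB : IsPureInjective B)
    (h : IsDirectSummand A B) : IsPureInjective A := by
  obtain ⟨i, p, h⟩ := h
  intro C D f hf g
  obtain ⟨k, hk⟩ := hB f hf (i ∘ₗ g)
  exact ⟨p ∘ₗ k, by rw [LinearMap.comp_assoc, hk, ← LinearMap.comp_assoc, h, LinearMap.id_comp]⟩

theorem IsPureInjective.pi {I : Type u} {M : I → ModuleCat.{u} R} (h : ∀ i, IsPureInjective (M i)) :
    IsPureInjective (ModuleCat.of R (∀ i, M i)) := by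
  intro C D f hf g
  choose k hk using fun i => h i f hf (LinearMap.proj i ∘ₗ g)
  exact ⟨LinearMap.pi k, LinearMap.ext fun c => funext fun i => LinearMap.congr_fun (hk i) c⟩

theorem IsPureInjective.isDirectSummand {A B : ModuleCat.{u} R} (hA : IsPureInjective A)
    {f : A →ₗ[R] B} (hf : IsPureEmbedding f) : IsDirectSummand A B := by
  obtain ⟨p, hp⟩ := hA f hf LinearMap.id
  exact ⟨f, p, hp⟩

/-- A pure-injective hull of `M` is a direct summand of every pure-injective module that contains
`M` as a pure submodule. -/
theorem IsPureInjectiveHull.isDirectSummand {M H E : ModuleCat.{u} R} {i : M →ₗ[R] H}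
    (hi : IsPureInjectiveHull i) {j : M →ₗ[R] E} (hj : IsPureEmbedding j)
    (hE : IsPureInjective E) : IsDirectSummand H E := by
  obtain ⟨h, hh⟩ := hE i hi.isPureEmbedding j
  obtain ⟨g, hg⟩ := hi.isPureInjective j hj i
  have hb := hi.bijective_of_comp_eq (g ∘ₗ h) (by rw [LinearMap.comp_assoc, hh, hg])
  let e := LinearEquiv.ofBijective (g ∘ₗ h) hb
  exact ⟨h, e.symm.toLinearMap ∘ₗ g, LinearMap.ext fun x => e.symm_apply_apply x⟩

/-- Characters vanishing on a subgroup detect whether a family of constants makes a system of linear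
equations unsolvable. -/
theorem exists_characters_of_not_solvable {M : Type*} [AddCommGroup M] [Module R M]
    {ι κ : Type*} [Fintype ι] [Fintype κ] (r : ι → κ → R) (a : ι → M)
    (h : ¬ ∃ x : κ → M, ∀ i, ∑ j, r i j • x j = a i) :
    ∃ χ : ι → CharacterModule M, (∀ j, ∑ i, charScale (r i j) (χ i) = 0) ∧
      ∑ i, χ i (a i) ≠ 0 := by
  classical
  let T : (κ → M) →+ (ι → M) :=
    AddMonoidHom.mk' (fun x i => ∑ j, r i j • x j) fun x y => by
      funext i; simp [smul_add, Finset.sum_add_distrib]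
  have ha : (QuotientAddGroup.mk' T.range a) ≠ 0 := by
    intro h0
    obtain ⟨x, hx⟩ := (QuotientAddGroup.eq_zero_iff a).1 h0
    exact h ⟨x, fun i => congrFun hx i⟩
  obtain ⟨c, hc⟩ := CharacterModule.exists_character_apply_ne_zero_of_ne_zero ha
  let c' : CharacterModule (ι → M) := charComp (QuotientAddGroup.mk' T.range) c
  refine ⟨fun i => charComp (AddMonoidHom.single (fun _ : ι => M) i) c', fun j => ?_, ?_⟩
  · refine CharacterModule.ext _ fun x => ?_
    have h1 : c' (T (Pi.single j x)) = 0 := by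
      have : QuotientAddGroup.mk' T.range (T (Pi.single j x)) = 0 :=
        (QuotientAddGroup.eq_zero_iff _).2 ⟨_, rfl⟩
      change c _ = 0
      rw [this, map_zero]
    have h2 : T (Pi.single j x) = ∑ i, Pi.single i (r i j • x) := by
      funext k
      simp [T, Finset.sum_apply, Pi.single_apply]
    rw [h2, map_sum] at h1
    rw [character_sum_apply]
    exact h1
  · have : ∑ i, c' (Pi.single i (a i)) = c' a := by
      rw [← map_sum, Finset.univ_sum_single]
    exact fun h0 => hc (this.symm.trans h0)

end Pure

/-! ### Double character modules -/

section Bidual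

variable {R : Type u} [Ring R]

/-- If `N` consists of `T`-valued additive functionals on the characters of `M`, where `T` contains
`ℚ/ℤ`, then the evaluation map `M → N` is a pure embedding. -/
theorem isPureEmbedding_evaluation {M N : ModuleCat.{u} R} {T : Type*} [AddCommGroup T]
    (ι : AddCircle (1 : ℚ) →+ T) (hι : Function.Injective ι)
    (p : N →+ (CharacterModule M →+ T)) (hp : ∀ (r : R) n χ, p (r • n) χ = p n (charScale r χ))
    (j : M →ₗ[R] N) (hj : ∀ m χ, p (j m) χ = ι (χ m)) : IsPureEmbedding j := by
  refine ⟨(injective_iff_map_eq_zero j).2 fun m hm => ?_, fun k n r a ⟨y, hy⟩ => ?_⟩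
  · refine CharacterModule.eq_zero_of_character_apply fun χ => hι ?_
    rw [← hj, hm, map_zero, map_zero, AddMonoidHom.zero_apply]
  · by_contra h
    obtain ⟨χ, h1, h2⟩ := exists_characters_of_not_solvable r a h
    refine h2 (hι ?_)
    have : ∀ i, ι (χ i (a i)) = ∑ j, p (y j) (charScale (r i j) (χ i)) := fun i => by
      rw [← hj, ← hy, map_sum, AddMonoidHom.finsetSum_apply]
      simp only [hp]
    rw [map_sum, Finset.sum_congr rfl fun i _ => this i, Finset.sum_comm, map_zero]
    refine Finset.sum_eq_zero fun l _ => ?_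
    rw [← map_sum, h1, map_zero]

theorem exists_character_comp_eq {A B : Type*} [AddCommGroup A] [AddCommGroup B] (f : A →+ B)
    (φ : A →+ AddCircle (1 : ℚ)) (h : ∀ a, f a = 0 → φ a = 0) :
    ∃ ψ : B →+ AddCircle (1 : ℚ), ∀ a, ψ (f a) = φ a := by
  obtain ⟨ψ, hψ⟩ := (Module.Baer.of_divisible
    (AddCircle (1 : ℚ))).extension_property_addMonoidHom (QuotientAddGroup.kerLift f)
    (QuotientAddGroup.kerLift_injective f) (QuotientAddGroup.lift f.ker φ fun a ha => h a ha)
  exact ⟨ψ, fun a => DFunLike.congr_fun hψ (QuotientAddGroup.mk a)⟩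

variable {M N : ModuleCat.{u} R} (p : N ≃+ (CharacterModule M →+ AddCircle (1 : ℚ)))
  (hp : ∀ (r : R) n χ, p (r • n) χ = p n (charScale r χ))

include hp in
/-- If every family of characters annihilated by the coefficients also annihilated the constants,
then extending a character would give a solution in the double character module `N`. -/
theorem exists_characters_of_not_solvable_bidual {ι κ : Type*} [Fintype ι] [Fintype κ]
    (r : ι → κ → R) (a : ι → N) (h : ¬ ∃ x : κ → N, ∀ i, ∑ j, r i j • x j = a i) :
    ∃ χ : ι → CharacterModule M, (∀ j, ∑ i, charScale (r i j) (χ i) = 0) ∧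
      ∑ i, p (a i) (χ i) ≠ 0 := by
  classical
  by_contra! hc
  let D : (ι → CharacterModule M) →+ (κ → CharacterModule M) :=
    AddMonoidHom.mk' (fun χ j => ∑ i, charScale (r i j) (χ i)) fun χ ψ => by
      funext j; simp [Finset.sum_add_distrib]
  let Φ : (ι → CharacterModule M) →+ AddCircle (1 : ℚ) :=
    AddMonoidHom.mk' (fun χ => ∑ i, p (a i) (χ i)) fun χ ψ => by simp [Finset.sum_add_distrib]
  obtain ⟨Ψ, hΨ⟩ := exists_character_comp_eq D Φ fun χ hχ => hc χ fun j => congrFun hχ j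
  refine h ⟨fun j => p.symm (Ψ.comp (AddMonoidHom.single (fun _ : κ => CharacterModule M) j)),
    fun i => p.injective (AddMonoidHom.ext fun χ => ?_)⟩
  have h1 : D (Pi.single i χ) = ∑ j, Pi.single j (charScale (r i j) χ) := by
    funext k
    simp only [D, AddMonoidHom.mk'_apply, Finset.sum_apply]
    rw [Finset.sum_eq_single i (fun b _ hb => by simp [Pi.single_eq_of_ne hb]) (by simp),
      Finset.sum_eq_single k (fun b _ hb => by simp [Pi.single_eq_of_ne hb.symm]) (by simp)]
    simp
  have h2 : Φ (Pi.single i χ) = p (a i) χ := by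
    simp only [Φ, AddMonoidHom.mk'_apply]
    rw [Finset.sum_eq_single i (fun b _ hb => by simp [Pi.single_eq_of_ne hb]) (by simp)]
    simp
  rw [← h2, ← hΨ, h1, map_sum, map_sum, AddMonoidHom.finsetSum_apply]
  refine Finset.sum_congr rfl fun j _ => ?_
  rw [hp, AddEquiv.apply_symm_apply]
  rfl

include hp in
/-- Finitely many linear relations among elements of the double character module `N` of `M` can be
reflected into `M` in such a way that a given unsolvable system stays unsolvable. Otherwise a
character separating the system would be a combination of the given relations, hence
vanish in `N`. -/
theorem exists_partial_retraction_bidual {ι κ : Type*} [Fintype ι] [Fintype κ]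
    (r : ι → κ → R) (a : ι → N) (h : ¬ ∃ x : κ → N, ∀ i, ∑ j, r i j • x j = a i)
    (C : Finset (N →₀ R)) (hC : ∀ c ∈ C, Finsupp.linearCombination R id c = (0 : N)) :
    ∃ ρ : N → M, (¬ ∃ x : κ → M, ∀ i, ∑ j, r i j • x j = ρ (a i)) ∧
      ∀ c ∈ C, Finsupp.linearCombination R ρ c = 0 := by
  classical
  obtain ⟨χ, h1, h2⟩ := exists_characters_of_not_solvable_bidual p hp r a h
  by_contra hρ
  have hρ0 : ∀ ρ : N → M, (∀ c ∈ C, Finsupp.linearCombination R ρ c = 0) →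
      ∑ i, χ i (ρ (a i)) = 0 := by
    intro ρ hc
    by_contra hne
    refine hρ ⟨ρ, ?_, hc⟩
    rintro ⟨x, hx⟩
    refine hne ?_
    simp only [← hx, map_sum]
    rw [Finset.sum_comm]
    refine Finset.sum_eq_zero fun j _ => ?_
    have := DFunLike.congr_fun (h1 j) (x j)
    rw [character_sum_apply] at this
    exact this
  let θ : (N → M) →+ (C → M) :=
    AddMonoidHom.mk' (fun ρ c => Finsupp.linearCombination R ρ c.1) fun ρ ρ' => by
      funext c; simp [Finsupp.linearCombination_apply, Finsupp.sum_add]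
  let Φ : (N → M) →+ AddCircle (1 : ℚ) :=
    AddMonoidHom.mk' (fun ρ => ∑ i, χ i (ρ (a i))) fun ρ ρ' => by
      simp [Finset.sum_add_distrib]
  obtain ⟨ψ, hψ⟩ := exists_character_comp_eq θ Φ fun ρ hρ =>
    hρ0 ρ fun c hc => congrFun hρ ⟨c, hc⟩
  let ψ' : C → CharacterModule M := fun c => ψ.comp (AddMonoidHom.single (fun _ : C => M) c)
  -- Elements of `N →₀ CharacterModule M` are functionals both on functions `N → M` and on `N`;
  -- the equation `ψ ∘ θ = Φ` is an equality of such elements.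
  let W₁ : N →₀ CharacterModule M := ∑ i, Finsupp.single (a i) (χ i)
  let W₂ : N →₀ CharacterModule M :=
    ∑ c : C, ∑ n ∈ c.1.support, Finsupp.single n (charScale (c.1 n) (ψ' c))
  have hW : ∀ ρ : N → M,
      Finsupp.liftAddHom (fun n => charEval (ρ n)) W₁ =
      Finsupp.liftAddHom (fun n => charEval (ρ n)) W₂ := by
    intro ρ
    have e1 : ψ (θ ρ) = ∑ c : C, ψ' c (θ ρ c) := by
      conv_lhs => rw [← Finset.univ_sum_single (θ ρ), map_sum]
      rfl
    have e2 := hψ ρ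
    rw [e1] at e2
    simp only [W₁, W₂, map_sum, Finsupp.liftAddHom_apply_single, charEval_apply]
    refine e2.symm.trans (Finset.sum_congr rfl fun c _ => ?_)
    simp only [θ, AddMonoidHom.mk'_apply, Finsupp.linearCombination_apply, Finsupp.sum, map_sum]
    rfl
  have hsingle : ∀ (W : N →₀ CharacterModule M) n x,
      Finsupp.liftAddHom (fun k => charEval ((Pi.single n x : N → M) k)) W = W n x := by
    intro W n x
    rw [Finsupp.liftAddHom_apply, Finsupp.sum]
    by_cases hn : n ∈ W.support
    · rw [Finset.sum_eq_single n]
      · simp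
      · intro b _ hb
        simp [Pi.single_eq_of_ne hb]
      · exact fun h => absurd hn h
    · rw [Finsupp.notMem_support_iff.1 hn]
      refine Finset.sum_eq_zero fun b hb => ?_
      have : b ≠ n := fun e => hn (e ▸ hb)
      simp [Pi.single_eq_of_ne this]
  have hWeq : W₁ = W₂ := by
    refine Finsupp.ext fun n => CharacterModule.ext _ fun x => ?_
    rw [← hsingle, ← hsingle]
    exact hW _
  have hev := congrArg (Finsupp.liftAddHom fun n => p n) hWeq
  simp only [W₁, W₂, map_sum, Finsupp.liftAddHom_apply_single] at hev
  refine h2 (hev.trans (Finset.sum_eq_zero fun c _ => ?_))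
  have h3 := congrArg p (hC c.1 c.2)
  rw [Finsupp.linearCombination_apply, Finsupp.sum, map_sum, map_zero] at h3
  have h4 := DFunLike.congr_fun h3 (ψ' c)
  rw [AddMonoidHom.finsetSum_apply] at h4
  simp only [hp, id] at h4
  exact h4

include hp in
theorem exists_isAsymptoticallyLinear_bidual {ι κ : Type*} [Fintype ι] [Fintype κ]
    (r : ι → κ → R) (a : ι → N) (h : ¬ ∃ x : κ → N, ∀ i, ∑ j, r i j • x j = a i) :
    ∃ l : Filter {ρ : N → M // ¬ ∃ x : κ → M, ∀ i, ∑ j, r i j • x j = ρ (a i)}, l.NeBot ∧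
      IsAsymptoticallyLinear R l (G := fun _ => M) fun ρ => ρ.1 := by
  classical
  obtain ⟨l, hl, hmem⟩ := exists_neBot_filter_forall_mem
    (fun c : {c : N →₀ R // Finsupp.linearCombination R id c = (0 : N)} =>
      {ρ : {ρ : N → M // ¬ ∃ x : κ → M, ∀ i, ∑ j, r i j • x j = ρ (a i)} |
        Finsupp.linearCombination R ρ.1 c.1 = 0}) fun F => by
    obtain ⟨ρ, h1, h2⟩ := exists_partial_retraction_bidual p hp r a h (F.image Subtype.val) (by
      intro c hc
      obtain ⟨c, -, rfl⟩ := Finset.mem_image.1 hc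
      exact c.2)
    exact ⟨⟨ρ, h1⟩, fun c hc => h2 c.1 (Finset.mem_image_of_mem _ hc)⟩
  refine ⟨l, hl, fun b b' => ?_, fun s b => ?_⟩
  · filter_upwards [hmem ⟨Finsupp.single (b + b') 1 - Finsupp.single b 1 - Finsupp.single b' 1,
      by simp⟩] with ρ hρ
    simpa [sub_sub, sub_eq_zero] using hρ
  · filter_upwards [hmem ⟨Finsupp.single (s • b) 1 - Finsupp.single b s, by simp⟩] with ρ hρ
    simpa [sub_eq_zero] using hρ

end Bidual

/-! ### Reduced powers in definable classes -/

section Reduced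

variable {R : Type u} [Ring R]

/-- An asymptotically linear family `ρ x : N → M` with `M` in a definable class `X` is induced by a
linear map from `N` to a member `L` of `X`, the reduced power of `M` along `l`. It is obtained here
as the direct limit of the powers `M ^ s` over the sets `s ∈ l`. -/
theorem IsDefinable.exists_reducedPower {X : ObjectProperty (ModuleCat.{u} R)}
    (hX : IsDefinable X) {M N : ModuleCat.{u} R} (hM : X M) {Y : Type u} (l : Filter Y)
    {ρ : Y → N → M} (hρ : IsAsymptoticallyLinear R l (G := fun _ => M) ρ) :
    ∃ (L : ModuleCat.{u} R) (g : N →ₗ[R] L), X L ∧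
      ∀ {m n : ℕ} (r : Matrix (Fin m) (Fin n) R) (a : Fin m → N),
        (∃ y : Fin n → L, ∀ i, ∑ j, r i j • y j = g (a i)) →
          ∀ᶠ x in l, ∃ z : Fin n → M, ∀ i, ∑ j, r i j • z j = ρ x (a i) := by
  classical
  let I : Type u := {s : Set Y // s ∈ l}ᵒᵈ
  let S : I → Set Y := fun s => (OrderDual.ofDual s).1
  have hS : ∀ {s t : I}, s ≤ t → S t ⊆ S s := fun h => h
  have hSl : ∀ s : I, S s ∈ l := fun s => (OrderDual.ofDual s).2
  have : Nonempty I := ⟨OrderDual.toDual ⟨Set.univ, Filter.univ_mem⟩⟩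
  have : IsDirectedOrder I := ⟨fun s t =>
    ⟨OrderDual.toDual ⟨S s ∩ S t, Filter.inter_mem (hSl s) (hSl t)⟩,
      Set.inter_subset_left, Set.inter_subset_right⟩⟩
  let G : I → ModuleCat.{u} R := fun s => ModuleCat.of R (S s → M)
  let f : ∀ s t : I, s ≤ t → G s →ₗ[R] G t :=
    fun s t h => LinearMap.funLeft R M (Set.inclusion (hS h))
  have : DirectedSystem (fun s => G s) fun s t h => f s t h :=
    ⟨fun _ _ => rfl, fun _ _ _ _ _ _ => rfl⟩
  let L := Module.DirectLimit (fun s => G s) f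
  let o : ∀ s, G s →ₗ[R] L := fun s => Module.DirectLimit.of R I (fun s => G s) f s
  let c : (Y → M) → L := fun v => o (OrderDual.toDual ⟨Set.univ, Filter.univ_mem⟩) fun x => v x
  have hc : ∀ (s : I) (v : Y → M), c v = o s fun x => v x := fun s v =>
    (Module.DirectLimit.of_f (G := fun s => G s) (f := f) (i := OrderDual.toDual
      ⟨Set.univ, Filter.univ_mem⟩) (hij := Set.subset_univ (S s))).symm
  have hceq : ∀ v w : Y → M, (∀ᶠ x in l, v x = w x) → c v = c w := by
    intro v w h
    let s : I := OrderDual.toDual ⟨{x | v x = w x}, h⟩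
    rw [hc s v, hc s w]
    exact congrArg (o s) (funext fun x => x.2)
  have hcadd : ∀ v w, c (v + w) = c v + c w := fun v w =>
    map_add (o (OrderDual.toDual ⟨Set.univ, Filter.univ_mem⟩)) _ _
  have hcsmul : ∀ (t : R) v, c (t • v) = t • c v := fun t v =>
    map_smul (o (OrderDual.toDual ⟨Set.univ, Filter.univ_mem⟩)) t _
  have hcsurj : Function.Surjective c := by
    intro z
    obtain ⟨s, x, rfl⟩ := Module.DirectLimit.exists_of z
    let v : Y → M := fun y => if h : y ∈ S s then x ⟨y, h⟩ else 0
    have hx : (fun y : S s => v y) = x := funext fun y => dif_pos y.2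
    exact ⟨v, (hc s v).trans (congrArg (o s) hx)⟩
  have hcinj : ∀ v w, c v = c w → ∀ᶠ x in l, v x = w x := by
    intro v w h
    obtain ⟨s, _, hs⟩ := Module.DirectLimit.exists_eq_of_of_eq h
    exact Filter.mem_of_superset (hSl s) fun x hx => congrFun hs ⟨x, hx⟩
  refine ⟨ModuleCat.of R L,
    { toFun := fun n => c fun x => ρ x n
      map_add' := fun n n' => (hceq _ _ (hρ.add n n')).trans
        (hcadd (fun x => ρ x n) fun x => ρ x n')
      map_smul' := fun t n => (hceq _ _ (hρ.smul t n)).trans (hcsmul t fun x => ρ x n) },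
    hX.directLimit I G f fun s => hX.prod _ _ fun _ => hM, ?_⟩
  rintro m n r a ⟨y, hy⟩
  choose z hz using fun j => hcsurj (y j)
  have hcsum : ∀ i, c (∑ j, r i j • z j) = ∑ j, r i j • y j := fun i => by
    let cl : (Y → M) →ₗ[R] L := ⟨⟨c, hcadd⟩, hcsmul⟩
    exact (map_sum cl _ _).trans (Finset.sum_congr rfl fun j _ =>
      (hcsmul _ _).trans (congrArg (r i j • ·) (hz j)))
  have : ∀ᶠ x in l, ∀ i, (∑ j, r i j • z j) x = ρ x (a i) :=
    Filter.eventually_all.2 fun i => hcinj _ _ ((hcsum i).trans (hy i))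
  filter_upwards [this] with x hx
  exact ⟨fun j => z j x, fun i => by rw [← hx i]; simp [Finset.sum_apply]⟩

/-- A definable class is closed under double character modules: the double character module `N` of
`M` is pure in a product of reduced powers of `M`, one for each unsolvable system over `N`. -/
theorem IsDefinable.bidual {X : ObjectProperty (ModuleCat.{u} R)}
    (hX : IsDefinable X) {M N : ModuleCat.{u} R} (hM : X M)
    (p : N ≃+ (CharacterModule M →+ AddCircle (1 : ℚ)))
    (hp : ∀ (r : R) n χ, p (r • n) χ = p n (charScale r χ)) : X N := by
  let K : Type u := Σ m n : ℕ, {q : Matrix (Fin m) (Fin n) R × (Fin m → N) //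
    ¬ ∃ x : Fin n → N, ∀ i, ∑ j, q.1 i j • x j = q.2 i}
  have key : ∀ k : K, ∃ (L : ModuleCat.{u} R) (g : N →ₗ[R] L), X L ∧
      ¬ ∃ y : Fin k.2.1 → L, ∀ i, ∑ j, k.2.2.1.1 i j • y j = g (k.2.2.1.2 i) := by
    rintro ⟨m, n, ⟨r, a⟩, h⟩
    obtain ⟨l, hl, hlin⟩ := exists_isAsymptoticallyLinear_bidual p hp r a h
    obtain ⟨L, g, hL, hg⟩ := hX.exists_reducedPower hM l hlin
    refine ⟨L, g, hL, fun hy => ?_⟩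
    obtain ⟨ρ, hρ⟩ := (hg r a hy).exists
    exact ρ.2 hρ
  choose L g hL hg using key
  refine hX.pure (A := N) (B := ModuleCat.of R (∀ k, L k)) (LinearMap.pi g)
    ⟨(injective_iff_map_eq_zero _).2 fun n hn => ?_, fun m n r a ⟨y, hy⟩ => ?_⟩
    (hX.prod K L hL)
  · by_contra hne
    -- A nonzero element is an unsolvable system without variables.
    let k : K := ⟨1, 0, ⟨(fun _ => Fin.elim0, fun _ => n), fun ⟨x, hx⟩ => hne (by
      simpa using (hx 0).symm)⟩⟩
    exact hg k ⟨Fin.elim0, fun i => by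
      simp only [Finset.univ_eq_empty, Finset.sum_empty]
      exact (congrFun hn k).symm⟩
  · by_contra h
    let k : K := ⟨m, n, ⟨(r, a), h⟩⟩
    refine hg k ⟨fun j => y j k, fun i => ?_⟩
    have := congrFun (hy i) k
    rw [Finset.sum_apply] at this
    exact this

end Reduced

/-! ### Dualities between left and right modules -/

section Duality

variable {A B : Type u} [Ring A] [Ring B]

/-- What the arguments use about the two character dualities `d` and `d'` between left and right
modules: `d M` is the group of characters of `M`, where the scalar `σ a` acts by precomposition
with `a`, and likewise for `d'` with the inverse of `σ`. The structure is symmetric in `d`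
and `d'`, so that each statement about `d` also holds for `d'`. -/
structure DualityPair (d : ModuleCat.{u} A → ModuleCat.{u} B)
    (d' : ModuleCat.{u} B → ModuleCat.{u} A) where
  /-- the identification of the scalars of the two sides -/
  σ : A ≃ B
  /-- elements of `d M` as characters -/
  e : ∀ M : ModuleCat.{u} A, d M ≃+ CharacterModule M
  /-- elements of `d' N` as characters -/
  e' : ∀ N : ModuleCat.{u} B, d' N ≃+ CharacterModule N
  e_smul : ∀ M a n, e M (σ a • n) = charScale a (e M n)
  e'_smul : ∀ N b n, e' N (σ.symm b • n) = charScale b (e' N n)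

/-- The character dualities over a ring. -/
def leftRightDuality (R : Type u) [Ring R] : DualityPair (leftDual R) (rightDual R) where
  σ := opEquiv
  e M := AddEquiv.refl (CharacterModule M)
  e' N := AddEquiv.refl (CharacterModule N)
  e_smul _ _ _ := rfl
  e'_smul _ _ _ := rfl

namespace DualityPair

variable {d : ModuleCat.{u} A → ModuleCat.{u} B} {d' : ModuleCat.{u} B → ModuleCat.{u} A}

/-- The duality pair with its two sides interchanged. -/
def symm (D : DualityPair d d') : DualityPair d' d where
  σ := D.σ.symm
  e := D.e'
  e' := D.e
  e_smul := D.e'_smul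
  e'_smul := D.e_smul

/-- Additive maps from a module to `CharacterModule M` that are compatible with scalars, as linear
maps to `d M`. -/
def homMk (D : DualityPair d d') {N : ModuleCat.{u} B} {M : ModuleCat.{u} A}
    (h : N →+ CharacterModule M)
    (H : ∀ a n, h (D.σ a • n) = charScale a (h n)) : N →ₗ[B] d M where
  toFun n := (D.e M).symm (h n)
  map_add' x y := by simp
  map_smul' b n := by
    obtain ⟨a, rfl⟩ := D.σ.surjective b
    apply (D.e M).injective
    simp [H, D.e_smul]

@[simp] theorem e_homMk (D : DualityPair d d') {N : ModuleCat.{u} B} {M : ModuleCat.{u} A}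
    (h : N →+ CharacterModule M) (H : ∀ a n, h (D.σ a • n) = charScale a (h n)) (n : N) :
    D.e M (D.homMk h H n) = h n := by simp [homMk]

/-- Elements of the bidual `d' (d M)` as functionals on the characters of `M`. -/
def bidualEquiv (D : DualityPair d d') (M : ModuleCat.{u} A) :
    d' (d M) ≃+ (CharacterModule M →+ AddCircle (1 : ℚ)) :=
  (D.e' (d M)).trans
    { toFun := fun χ => AddMonoidHom.comp χ (D.e M).symm.toAddMonoidHom
      invFun := fun ξ => AddMonoidHom.comp ξ (D.e M).toAddMonoidHom
      left_inv := fun χ => CharacterModule.ext _ fun x =>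
        congrArg χ ((D.e M).symm_apply_apply x)
      right_inv := fun ξ => AddMonoidHom.ext fun x => by simp
      map_add' := fun _ _ => rfl }

theorem bidualEquiv_apply (D : DualityPair d d') (M : ModuleCat.{u} A) (ξ : d' (d M))
    (χ : CharacterModule M) :
    D.bidualEquiv M ξ χ = D.e' (d M) ξ ((D.e M).symm χ) := rfl

theorem bidualEquiv_smul (D : DualityPair d d') (M : ModuleCat.{u} A) (a : A) (ξ : d' (d M))
    (χ : CharacterModule M) :
    D.bidualEquiv M (a • ξ) χ = D.bidualEquiv M ξ (charScale a χ) := by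
  rw [bidualEquiv_apply, bidualEquiv_apply]
  obtain ⟨b, rfl⟩ := D.σ.symm.surjective a
  rw [D.e'_smul, charScale_apply]
  congr 1
  apply (D.e M).injective
  have := D.e_smul M (D.σ.symm b) ((D.e M).symm χ)
  simpa using this

/-- The evaluation map of a module into its bidual. -/
def evaluation (D : DualityPair d d') (M : ModuleCat.{u} A) : M →ₗ[A] d' (d M) where
  toFun m := (D.bidualEquiv M).symm (charEval m)
  map_add' x y := by
    rw [← map_add]
    congr 1
    exact AddMonoidHom.ext fun χ => map_add χ x y
  map_smul' a m := by
    apply (D.bidualEquiv M).injective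
    refine AddMonoidHom.ext fun χ => ?_
    rw [RingHom.id_apply, D.bidualEquiv_smul]
    simp

theorem isPureEmbedding_evaluation (D : DualityPair d d') (M : ModuleCat.{u} A) :
    IsPureEmbedding (D.evaluation M) :=
  DualPairs.isPureEmbedding_evaluation (AddMonoidHom.id _) Function.injective_id
    (D.bidualEquiv M).toAddMonoidHom (D.bidualEquiv_smul M) _ fun m χ =>
      DFunLike.congr_fun ((D.bidualEquiv M).apply_symm_apply (charEval m)) χ

theorem bidual_mem (D : DualityPair d d') {X : ObjectProperty (ModuleCat.{u} A)}
    (hX : IsDefinable X) {M : ModuleCat.{u} A} (hM : X M) : X (d' (d M)) :=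
  hX.bidual hM (D.bidualEquiv M) (D.bidualEquiv_smul M)

/-- Dual modules are pure-injective. -/
theorem isPureInjective_dual (D : DualityPair d d') (M : ModuleCat.{u} A) :
    IsPureInjective (d M) := by
  intro C C' f hf g
  obtain ⟨Γ, h1, h2⟩ := hf.exists_character_section
  let χ : M →+ CharacterModule C :=
    { toFun := fun m => (charEval m).comp ((D.e M).toAddMonoidHom.comp g.toAddMonoidHom)
      map_zero' := CharacterModule.ext _ fun c => map_zero (D.e M (g c))
      map_add' := fun x y => CharacterModule.ext _ fun c => map_add (D.e M (g c)) x y }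
  have hχ : ∀ m c, χ m c = D.e M (g c) m := fun _ _ => rfl
  have hχs : ∀ a m, χ (a • m) = charScale (D.σ a) (χ m) := fun a m =>
    CharacterModule.ext _ fun c => by simp [hχ, D.e_smul]
  let h : C' →+ CharacterModule M := AddMonoidHom.mk' (fun c' => (charEval c').comp (Γ.comp χ))
    fun x y => CharacterModule.ext _ fun m => map_add (Γ (χ m)) x y
  have hh : ∀ c' m, h c' m = Γ (χ m) c' := fun _ _ => rfl
  refine ⟨D.homMk h fun a n => CharacterModule.ext _ fun m => ?_, LinearMap.ext fun c => ?_⟩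
  · rw [charScale_apply, hh, hh, hχs, h1, charScale_apply]
  · apply (D.e M).injective
    refine CharacterModule.ext _ fun m => ?_
    rw [LinearMap.comp_apply, e_homMk, hh, h2, hχ]

/-- The dual of a pure submodule is a direct summand. -/
theorem isDirectSummand_dual (D : DualityPair d d') {M N : ModuleCat.{u} A} {f : M →ₗ[A] N}
    (hf : IsPureEmbedding f) : IsDirectSummand (d M) (d N) := by
  obtain ⟨Γ, h1, h2⟩ := hf.exists_character_section
  refine ⟨D.homMk (Γ.comp (D.e M).toAddMonoidHom) fun a n => by simp [D.e_smul, h1],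
    D.homMk ((charComp f.toAddMonoidHom).comp (D.e N).toAddMonoidHom) fun a n =>
      CharacterModule.ext _ fun m => by simp [D.e_smul], LinearMap.ext fun n => ?_⟩
  apply (D.e M).injective
  refine CharacterModule.ext _ fun m => ?_
  simp [h2]

/-- If `N` is pure in `d M` with `M` in a definable class `S`, then `d' N` is a direct summand of
the bidual of `M`, hence lies in `S`. -/
theorem dual_mem_of_exists_pure (D : DualityPair d d') {S : ObjectProperty (ModuleCat.{u} A)}
    (hS : IsDefinable S) {N : ModuleCat.{u} B}
    (hN : ∃ M, S M ∧ ∃ f : N →ₗ[B] d M, IsPureEmbedding f) : S (d' N) := by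
  obtain ⟨M, hM, f, hf⟩ := hN
  exact hS.isDirectSummand (D.symm.isDirectSummand_dual hf) (D.bidual_mem hS hM)

/-- The dual of a direct sum is the product of the duals. -/
theorem exists_dual_dfinsupp_equiv (D : DualityPair d d') {I : Type u} (M : I → ModuleCat.{u} A) :
    Nonempty (d (ModuleCat.of A (Π₀ i, M i)) ≃ₗ[B] (ModuleCat.of B (∀ i, d (M i)))) := by
  classical
  let F : d (ModuleCat.of A (Π₀ i, M i)) →ₗ[B] (ModuleCat.of B (∀ i, d (M i))) :=
    LinearMap.pi fun i => D.homMk ((charComp (DFinsupp.singleAddHom (fun i => M i) i)).comp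
      (D.e (ModuleCat.of A (Π₀ i, M i))).toAddMonoidHom) fun a n =>
        CharacterModule.ext _ fun m => by simp [D.e_smul, DFinsupp.single_smul]
  have hF : ∀ χ i m, D.e (M i) (F χ i) m =
      D.e (ModuleCat.of A (Π₀ i, M i)) χ (DFinsupp.single i m : Π₀ i, M i) := fun χ i m => by
    simp only [F, LinearMap.pi_apply, e_homMk]
    rfl
  refine ⟨LinearEquiv.ofBijective F ⟨(injective_iff_map_eq_zero F).2 fun χ hχ => ?_, fun φ => ?_⟩⟩
  · apply (D.e _).injective
    rw [map_zero]
    have : (D.e (ModuleCat.of A (Π₀ i, M i)) χ : (Π₀ i, M i) →+ AddCircle (1 : ℚ)) = 0 :=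
      DFinsupp.addHom_ext fun i m => by
        refine (hF χ i m).symm.trans ?_
        rw [hχ]
        exact DFunLike.congr_fun (map_zero (D.e (M i))) m
    exact this
  · let ψ : CharacterModule (Π₀ i, M i) :=
      DFinsupp.liftAddHom (β := fun i => M i) fun i => (D.e (M i) (φ i) : M i →+ AddCircle (1 : ℚ))
    have hψ : ∀ i m, ψ (DFinsupp.single i m) = D.e (M i) (φ i) m := fun i m =>
      DFinsupp.liftAddHom_apply_single (β := fun i => M i) _ i m
    refine ⟨(D.e (ModuleCat.of A (Π₀ i, M i))).symm ψ, funext fun i => (D.e (M i)).injective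
      (CharacterModule.ext _ fun m => ?_)⟩
    rw [hF, AddEquiv.apply_symm_apply]
    exact hψ i m

/-- The dual of a direct limit is a direct summand of the product of the duals. -/
theorem isDirectSummand_dual_directLimit (D : DualityPair d d') {I : Type u} [Preorder I]
    [IsDirectedOrder I] [Nonempty I] [DecidableEq I] (G : I → ModuleCat.{u} A)
    (f : ∀ i j, i ≤ j → G i →ₗ[A] G j) [DirectedSystem (fun i => G i) fun i j h => f i j h] :
    IsDirectSummand (d (ModuleCat.of A (Module.DirectLimit (fun i => G i) f)))
      (ModuleCat.of B (∀ i, d (G i))) := by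
  obtain ⟨ρ, hρ, hof⟩ := exists_isAsymptoticallyLinear_directLimit (fun i => G i) f
  obtain ⟨Γ, h1, h2⟩ := hρ.exists_dualMap
  let L := ModuleCat.of A (Module.DirectLimit (fun i => G i) f)
  let o : ∀ i, G i →ₗ[A] L := fun i => Module.DirectLimit.of A I (fun i => G i) f i
  let E : (∀ i, d (G i)) →+ ∀ i, CharacterModule (G i) :=
    { toFun := fun φ i => D.e (G i) (φ i)
      map_zero' := funext fun i => map_zero _
      map_add' := fun φ ψ => funext fun i => map_add _ _ _ }
  refine ⟨LinearMap.pi fun i => D.homMk (N := d L) (M := G i)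
      ((charComp (o i).toAddMonoidHom).comp (D.e L).toAddMonoidHom) fun a n =>
        CharacterModule.ext _ fun m => by simp [D.e_smul],
    D.homMk (N := ModuleCat.of B (∀ i, d (G i))) (M := L) (Γ.comp E) fun a φ => ?_,
    LinearMap.ext fun χ => ?_⟩
  · have : E (D.σ a • φ) = fun i => charScale a (E φ i) := funext fun i => D.e_smul _ _ _
    rw [AddMonoidHom.comp_apply, AddMonoidHom.comp_apply, ← h1]
    exact congrArg Γ this
  · apply (D.e L).injective
    refine CharacterModule.ext _ fun z => ?_
    rw [LinearMap.comp_apply, e_homMk, AddMonoidHom.comp_apply, LinearMap.id_apply]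
    obtain ⟨i, x, rfl⟩ := Module.DirectLimit.exists_of z
    refine h2 _ _ _ ((hof i x).mono fun j hj => ?_)
    obtain ⟨hij, hj⟩ := hj
    rw [hj]
    simp only [E, AddMonoidHom.coe_mk, ZeroHom.coe_mk, LinearMap.pi_apply, e_homMk]
    exact congrArg (D.e L χ) Module.DirectLimit.of_f

end DualityPair

end Duality

/-! ### Existence of pure-injective hulls -/

section Hull

/-- A compact semigroup with continuous right translations has an idempotent `e` in a minimal left
ideal; the elements `e * t * e` are then left invertible relative to `e`. -/
theorem exists_idempotent_minimal {T : Type*} [Semigroup T] [Nonempty T] [TopologicalSpace T]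
    [CompactSpace T] [T2Space T] (hT : ∀ t : T, Continuous (· * t)) :
    ∃ e : T, e * e = e ∧ ∀ t : T, ∃ s : T, s * (e * t * e) = e := by
  let S : Set (Set T) := {L | IsClosed L ∧ L.Nonempty ∧ ∀ t, ∀ x ∈ L, t * x ∈ L}
  obtain ⟨L, hL⟩ : ∃ L, Minimal (· ∈ S) L := by
    refine zorn_superset _ fun c hcs hc => ?_
    refine ⟨⋂₀ c, ⟨isClosed_sInter fun t ht => (hcs ht).1, ?_, fun t x hx => ?_⟩,
      fun s hs => Set.sInter_subset_of_mem hs⟩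
    · obtain rfl | hne := c.eq_empty_or_nonempty
      · rw [Set.sInter_empty]
        exact Set.univ_nonempty
      · have := hne.to_subtype
        have hdir : DirectedOn (· ⊇ ·) c := IsChain.directedOn hc.symm
        rw [Set.sInter_eq_iInter]
        exact IsCompact.nonempty_iInter_of_directed_nonempty_isCompact_isClosed _
          hdir.directed_val (fun i => (hcs i.prop).2.1)
          (fun i => (hcs i.prop).1.isCompact) fun i => (hcs i.prop).1
    · exact Set.mem_sInter.2 fun s hs => (hcs hs).2.2 t x (Set.mem_sInter.1 hx s hs)
  obtain ⟨hLc, hLn, hLmul⟩ := hL.prop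
  obtain ⟨e, heL, he⟩ := exists_idempotent_in_compact_subsemigroup hT L hLn hLc.isCompact
    fun x _ y hy => hLmul x y hy
  refine ⟨e, he, fun t => ?_⟩
  have hmem : e * t * e ∈ L := hLmul _ _ heL
  have hL' : Set.range (· * (e * t * e)) = L := by
    refine hL.eq_of_subset ⟨?_, Set.range_nonempty _, ?_⟩ ?_
    · exact (isCompact_range (hT _)).isClosed
    · rintro s _ ⟨x, rfl⟩
      exact ⟨s * x, mul_assoc _ _ _⟩
    · rintro _ ⟨x, rfl⟩
      exact hLmul _ _ hmem
  rw [← hL'] at heL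
  exact heL

variable {R : Type u} [Ring R]

/-- A module with a compact Hausdorff topology for which addition and scalars are continuous is
pure-injective: a map is extended as a limit along asymptotic retractions. -/
theorem isPureInjective_of_compactSpace (E : ModuleCat.{u} R) [TopologicalSpace E]
    [CompactSpace E] [T2Space E] [ContinuousAdd E] [ContinuousConstSMul R E] :
    IsPureInjective E := by
  intro A B f hf g
  obtain ⟨l, hl, hlin, hret⟩ := hf.exists_isAsymptoticallyLinear
  let U := Ultrafilter.of l
  have hU : (U : Filter (B → A)) ≤ l := Ultrafilter.of_le l
  have hlim : ∀ b, ∃ z, Filter.Tendsto (fun ρ : B → A => g (ρ b)) U (nhds z) := fun b =>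
    ⟨_, (U.map fun ρ : B → A => g (ρ b)).le_nhds_lim⟩
  choose h hh using hlim
  refine ⟨{ toFun := h, map_add' := fun b b' => ?_, map_smul' := fun r b => ?_ },
    LinearMap.ext fun a => ?_⟩
  · refine tendsto_nhds_unique (hh (b + b')) (((hh b).add (hh b')).congr' ?_)
    filter_upwards [hU (hlin.add b b')] with ρ hρ
    rw [← map_add, ← hρ]
  · refine tendsto_nhds_unique (hh (r • b)) (((hh b).const_smul r).congr' ?_)
    filter_upwards [hU (hlin.smul r b)] with ρ hρ
    rw [← map_smul, ← hρ]
  · refine tendsto_nhds_unique (hh (f a)) (tendsto_const_nhds.congr' ?_)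
    filter_upwards [hU (hret a)] with ρ hρ
    rw [hρ]

/-- The endomorphisms of a compact module `E` over a submodule form a compact semigroup under
composition, with continuous right translations. The image of an idempotent in a minimal left ideal
is a retract of `E` whose endomorphisms over the submodule are bijective. -/
theorem exists_isPureInjectiveHull_of_compactSpace {M E : ModuleCat.{u} R} [TopologicalSpace E]
    [CompactSpace E] [T2Space E] [ContinuousAdd E] [ContinuousConstSMul R E]
    {i : M →ₗ[R] E} (hi : IsPureEmbedding i) :
    ∃ (H : ModuleCat.{u} R) (j : M →ₗ[R] H), IsPureInjectiveHull j := by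
  let T := {h : E → E // (∀ x y, h (x + y) = h x + h y) ∧ (∀ (r : R) x, h (r • x) = r • h x) ∧
    ∀ m, h (i m) = i m}
  let : Semigroup T :=
    { mul := fun s t => ⟨s.1 ∘ t.1, fun x y => by simp [t.2.1, s.2.1],
        fun r x => by simp [t.2.2.1, s.2.2.1], fun m => by simp [t.2.2.2, s.2.2.2]⟩
      mul_assoc := fun _ _ _ => rfl }
  have hmul : ∀ (s t : T) x, (s * t).1 x = s.1 (t.1 x) := fun _ _ _ => rfl
  have : Nonempty T := ⟨⟨id, fun _ _ => rfl, fun _ _ => rfl, fun _ => rfl⟩⟩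
  have hadd : IsClosed {h : E → E | ∀ x y, h (x + y) = h x + h y} := by
    simp only [Set.ofPred_forall]
    exact isClosed_iInter fun x => isClosed_iInter fun y => isClosed_eq (by fun_prop) (by fun_prop)
  have hsmul : IsClosed {h : E → E | ∀ (r : R) x, h (r • x) = r • h x} := by
    simp only [Set.ofPred_forall]
    exact isClosed_iInter fun r => isClosed_iInter fun x => isClosed_eq (by fun_prop)
      ((continuous_apply x).const_smul r)
  have hfix : IsClosed {h : E → E | ∀ m, h (i m) = i m} := by
    simp only [Set.ofPred_forall]
    exact isClosed_iInter fun m => isClosed_eq (by fun_prop) (by fun_prop)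
  have : CompactSpace T := isCompact_iff_compactSpace.1 (hadd.inter (hsmul.inter hfix)).isCompact
  obtain ⟨e, he, hinv⟩ := exists_idempotent_minimal (T := T) fun t =>
    Continuous.subtype_mk (f := fun s : T => s.1 ∘ t.1) (continuous_pi fun x =>
      (continuous_apply (t.1 x)).comp continuous_subtype_val) fun s => (s * t).2
  have hee : ∀ x, e.1 (e.1 x) = e.1 x := fun x => by rw [← hmul, he]
  let eL : E →ₗ[R] E := ⟨⟨e.1, e.2.1⟩, e.2.2.1⟩
  let H := ModuleCat.of R (LinearMap.range eL)
  let inc : H →ₗ[R] E := (LinearMap.range eL).subtype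
  let ret : E →ₗ[R] H := eL.rangeRestrict
  have hret : ret ∘ₗ inc = LinearMap.id := by
    refine LinearMap.ext fun x => ?_
    obtain ⟨_, y, rfl⟩ := x
    exact Subtype.ext (hee y)
  have hreti : ∀ x, ret (inc x) = x := LinearMap.congr_fun hret
  have hinc : ∀ x, inc (ret x) = e.1 x := fun _ => rfl
  let j : M →ₗ[R] H := ret ∘ₗ i
  have hj : inc ∘ₗ j = i := LinearMap.ext fun m => e.2.2.2 m
  refine ⟨H, j, ?_, (isPureInjective_of_compactSpace E).of_isDirectSummand ⟨inc, ret, hret⟩, ?_⟩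
  · refine IsPureEmbedding.of_comp (g := inc) ?_
    rwa [hj]
  -- Endomorphisms of `H` over `M` have left inverses over `M`, hence are invertible.
  have key : ∀ h : H →ₗ[R] H, h ∘ₗ j = j → ∃ k : H →ₗ[R] H, k ∘ₗ j = j ∧ k ∘ₗ h = LinearMap.id := by
    intro h hh
    have hhj : ∀ m, h (j m) = j m := LinearMap.congr_fun hh
    let t : T := ⟨fun x => inc (h (ret x)), fun x y => by simp, fun r x => by simp, fun m =>
      (congrArg inc (hhj m)).trans (LinearMap.congr_fun hj m)⟩
    obtain ⟨s, hs⟩ := hinv t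
    let sL : E →ₗ[R] E := ⟨⟨s.1, s.2.1⟩, s.2.2.1⟩
    refine ⟨ret ∘ₗ sL ∘ₗ inc, LinearMap.ext fun m => ?_, LinearMap.ext fun x => ?_⟩
    · change ret (s.1 (inc (j m))) = j m
      rw [show inc (j m) = i m from LinearMap.congr_fun hj m, s.2.2.2]
      rfl
    · have h1 : s.1 (e.1 (inc (h (ret (e.1 (inc x)))))) = e.1 (inc x) := congrFun
        (congrArg Subtype.val hs) (inc x)
      rw [← hinc, ← hinc, hreti, hreti, hreti] at h1
      change ret (s.1 (inc (h x))) = x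
      rw [h1, hreti]
  intro h hh
  obtain ⟨k, hk, hkh⟩ := key h hh
  obtain ⟨k', -, hk'⟩ := key k hk
  have hkh' : ∀ x, k (h x) = x := LinearMap.congr_fun hkh
  have hk'' : ∀ x, k' (k x) = x := LinearMap.congr_fun hk'
  refine ⟨Function.LeftInverse.injective hkh', fun x => ⟨k x, ?_⟩⟩
  rw [← hk'' (h (k x)), hkh', hk'']

theorem exists_injective_addCircle :
    ∃ ι : AddCircle (1 : ℚ) →+ UnitAddCircle, Function.Injective ι := by
  let ι : AddCircle (1 : ℚ) →+ UnitAddCircle :=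
    QuotientAddGroup.map _ _ (Rat.castHom ℝ).toAddMonoidHom (by
      rintro _ ⟨n, rfl⟩
      exact ⟨n, by simp⟩)
  refine ⟨ι, (injective_iff_map_eq_zero ι).2 fun q hq => ?_⟩
  induction q using QuotientAddGroup.induction_on with
  | H q =>
    obtain ⟨n, hn⟩ := (AddCircle.coe_eq_zero_iff (1 : ℝ) (x := (q : ℝ))).1 hq
    refine (AddCircle.coe_eq_zero_iff (1 : ℚ)).2 ⟨n, ?_⟩
    simp only [zsmul_eq_mul, mul_one] at hn ⊢
    exact_mod_cast hn

/-- The module structure on the compact group `Hom(M*, ℝ/ℤ)`, where `M*` is the group of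
`ℚ/ℤ`-valued characters. -/
abbrev circleBidualModule (M : ModuleCat.{u} R) :
    Module R (CharacterModule M →+ UnitAddCircle) where
  smul r ξ := ξ.comp (charScale r)
  one_smul ξ := AddMonoidHom.ext fun χ => congrArg ξ (CharacterModule.ext _ fun m =>
    congrArg χ (one_smul R m))
  mul_smul r s ξ := AddMonoidHom.ext fun χ => congrArg ξ (CharacterModule.ext _ fun m =>
    congrArg χ (mul_smul r s m))
  smul_zero _ := rfl
  smul_add _ _ _ := rfl
  add_smul r s ξ := AddMonoidHom.ext fun χ => (congrArg ξ (CharacterModule.ext _ fun m =>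
    (congrArg χ (add_smul r s m)).trans (map_add χ _ _))).trans (map_add ξ _ _)
  zero_smul ξ := AddMonoidHom.ext fun χ => (congrArg ξ (CharacterModule.ext _ fun m =>
    (congrArg χ (zero_smul R m)).trans (map_zero χ))).trans (map_zero ξ)

/-- Every module has a pure-injective hull. -/
theorem exists_isPureInjectiveHull (M : ModuleCat.{u} R) :
    ∃ (H : ModuleCat.{u} R) (j : M →ₗ[R] H), IsPureInjectiveHull j := by
  obtain ⟨ι, hι⟩ := exists_injective_addCircle
  let : Module R (CharacterModule M →+ UnitAddCircle) := circleBidualModule M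
  have hsmul : ∀ (r : R) (ξ : CharacterModule M →+ UnitAddCircle) χ,
    (r • ξ) χ = ξ (charScale r χ) := fun _ _ _ => rfl
  let E : ModuleCat.{u} R := ModuleCat.of R (CharacterModule M →+ UnitAddCircle)
  let c : E → (CharacterModule M → UnitAddCircle) := fun ξ χ =>
    (ξ : CharacterModule M →+ UnitAddCircle) χ
  have hc : Function.Injective c := fun ξ ξ' h => DFunLike.coe_injective h
  let : TopologicalSpace E := TopologicalSpace.induced c inferInstance
  have hemb : Topology.IsEmbedding c := ⟨⟨rfl⟩, hc⟩
  have hclosed : Topology.IsClosedEmbedding c := by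
    refine ⟨hemb, ?_⟩
    have : Set.range c = {v | ∀ χ χ', v (χ + χ') = v χ + v χ'} := by
      refine Set.ext fun v => ⟨?_, fun hv => ⟨AddMonoidHom.mk' v hv, rfl⟩⟩
      rintro ⟨ξ, rfl⟩ χ χ'
      exact map_add (ξ : CharacterModule M →+ UnitAddCircle) χ χ'
    rw [this]
    simp only [Set.ofPred_forall]
    exact isClosed_iInter fun x => isClosed_iInter fun y => isClosed_eq (by fun_prop)
      (by fun_prop)
  have : CompactSpace E := hclosed.compactSpace
  have : T2Space E := hemb.t2Space
  have hev : ∀ χ : CharacterModule M, Continuous fun ξ : E => c ξ χ := fun χ =>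
    (continuous_apply χ).comp hemb.continuous
  have : ContinuousAdd E := ⟨hemb.continuous_iff.2 (continuous_pi fun χ =>
    ((hev χ).comp continuous_fst).add ((hev χ).comp continuous_snd))⟩
  have : ContinuousConstSMul R E := ⟨fun r => hemb.continuous_iff.2 (continuous_pi fun χ =>
    hev (charScale r χ))⟩
  let i : M →ₗ[R] E :=
    { toFun := fun m => ι.comp (charEval m)
      map_add' := fun x y => AddMonoidHom.ext fun χ =>
        (congrArg ι (map_add χ x y)).trans (map_add ι _ _)
      map_smul' := fun r x => AddMonoidHom.ext fun χ => rfl }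
  have hi : IsPureEmbedding i := isPureEmbedding_evaluation ι hι
    (AddMonoidHom.id (CharacterModule M →+ UnitAddCircle)) hsmul i fun _ _ => rfl
  exact exists_isPureInjectiveHull_of_compactSpace hi

end Hull

/-! ### Classes of modules -/

section Classes

variable {R : Type u} [Ring R]

/-- A class that is closed under products and direct summands contains its `Prod`-closure. -/
theorem prodClosure_le {X Y : ObjectProperty (ModuleCat.{u} R)} (hXY : X ≤ Y)
    (hprod : ∀ (I : Type u) (M : I → ModuleCat.{u} R), (∀ i, Y (M i)) →
      Y (ModuleCat.of R (∀ i, M i)))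
    (hsum : ∀ {M N : ModuleCat.{u} R}, IsDirectSummand M N → Y N → Y M) : ProdClosure X ≤ Y := by
  intro M hM
  induction hM with
  | of M hM => exact hXY M hM
  | prod I M _ ih => exact hprod I M ih
  | summand A B hAB _ ih => exact hsum hAB ih

theorem IsDefinable.eq_prodClosure {X : ObjectProperty (ModuleCat.{u} R)} (hX : IsDefinable X) :
    X = ProdClosure X :=
  le_antisymm (fun M hM => ProdClosure.of M hM)
    (prodClosure_le le_rfl hX.prod hX.isDirectSummand)

theorem le_pureClosure (X : ObjectProperty (ModuleCat.{u} R)) : X ≤ PureClosure X := fun M hM =>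
  ⟨M, LinearMap.id, hM, isPureEmbedding_of_comp_eq_id (p := LinearMap.id) rfl⟩

theorem PureClosure.of_isPureEmbedding {X : ObjectProperty (ModuleCat.{u} R)}
    {M N : ModuleCat.{u} R} {f : M →ₗ[R] N} (hf : IsPureEmbedding f) (hN : PureClosure X N) :
    PureClosure X M := by
  obtain ⟨B, g, hB, hg⟩ := hN
  exact ⟨B, g ∘ₗ f, hB, hg.comp hf⟩

end Classes

/-! ### Almost dual pairs -/

namespace IsAlmostDualPair

variable {A B : Type u} [Ring A] [Ring B] {d : ModuleCat.{u} A → ModuleCat.{u} B}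
  {d' : ModuleCat.{u} B → ModuleCat.{u} A}
  {S : ObjectProperty (ModuleCat.{u} A)} {P : ObjectProperty (ModuleCat.{u} B)}

theorem prod_mem (h : IsAlmostDualPair d S P) {I : Type u} (M : I → ModuleCat.{u} B)
    (hM : ∀ i, P (M i)) : P (ModuleCat.of B (∀ i, M i)) := by
  rw [h.eq_prodClosure]
  exact ProdClosure.prod I M fun i => ProdClosure.of _ (hM i)

theorem summand_mem (h : IsAlmostDualPair d S P) {M N : ModuleCat.{u} B}
    (hMN : IsDirectSummand M N) (hN : P N) : P M := by
  rw [h.eq_prodClosure]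
  exact ProdClosure.summand _ _ hMN (ProdClosure.of _ hN)

/-- A pure-injective module in `P⁺` belongs to `P`. -/
theorem mem_of_pureClosure (h : IsAlmostDualPair d S P) {N : ModuleCat.{u} B}
    (hN : PureClosure P N) (hi : IsPureInjective N) : P N := by
  obtain ⟨C, f, hC, hf⟩ := hN
  exact h.summand_mem (hi.isDirectSummand hf) hC

theorem left_pure (h : IsAlmostDualPair d S P) (D : DualityPair d d') {M N : ModuleCat.{u} A}
    {f : M →ₗ[A] N} (hf : IsPureEmbedding f) (hN : S N) : S M := by
  rw [h.mem_iff] at hN ⊢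
  exact h.summand_mem (D.isDirectSummand_dual hf) hN

theorem left_summand (h : IsAlmostDualPair d S P) (D : DualityPair d d') {M N : ModuleCat.{u} A}
    (hMN : IsDirectSummand M N) (hN : S N) : S M := by
  obtain ⟨f, hf⟩ := hMN.exists_isPureEmbedding
  exact h.left_pure D hf hN

theorem left_dfinsupp (h : IsAlmostDualPair d S P) (D : DualityPair d d') {I : Type u}
    (M : I → ModuleCat.{u} A) (hM : ∀ i, S (M i)) : S (ModuleCat.of A (Π₀ i, M i)) := by
  rw [h.mem_iff]
  obtain ⟨e⟩ := D.exists_dual_dfinsupp_equiv M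
  exact h.summand_mem (isDirectSummand_of_linearEquiv e)
    (h.prod_mem _ fun i => (h.mem_iff _).1 (hM i))

/-- Every module in `Prod(S*)` is a direct summand of the dual of a module in `S`, because a product
of duals is the dual of a direct sum. -/
theorem exists_isDirectSummand_of_prodClosure (h : IsAlmostDualPair d S P) (D : DualityPair d d')
    {N : ModuleCat.{u} B} (hN : ProdClosure (dualClass d S) N) :
    ∃ M, S M ∧ IsDirectSummand N (d M) := by
  induction hN with
  | of N hN =>
    obtain ⟨M, hM, ⟨e⟩⟩ := hN
    exact ⟨M, hM, isDirectSummand_of_linearEquiv e⟩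
  | prod I N _ ih =>
    choose M hM hs using ih
    obtain ⟨e⟩ := D.exists_dual_dfinsupp_equiv M
    exact ⟨_, h.left_dfinsupp D M hM, (IsDirectSummand.pi hs).trans
      (isDirectSummand_of_linearEquiv e.symm)⟩
  | summand N N' hNN' _ ih =>
    obtain ⟨M, hM, hs⟩ := ih
    exact ⟨M, hM, hNN'.trans hs⟩

theorem dual_mem_of_pureClosure (h : IsAlmostDualPair d S P) (D : DualityPair d d')
    (H : ∀ N, P N → S (d' N)) {N : ModuleCat.{u} B} (hN : PureClosure P N) : S (d' N) := by
  obtain ⟨C, f, hC, hf⟩ := hN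
  exact h.left_summand D (D.symm.isDirectSummand_dual hf) (H C hC)

/-- If the duals of the modules in `P` lie in `S`, then `S` is closed under products: `∏ Mᵢ` is pure
in `∏ Mᵢ** = (⨁ Mᵢ*)*`, and `⨁ Mᵢ*` is pure in `∏ Mᵢ*`, which lies in `P`. -/
theorem left_prod (h : IsAlmostDualPair d S P) (D : DualityPair d d')
    (H : ∀ N, P N → S (d' N)) {I : Type u} (M : I → ModuleCat.{u} A) (hM : ∀ i, S (M i)) :
    S (ModuleCat.of A (∀ i, M i)) := by
  refine h.left_pure D (IsPureEmbedding.pi fun i => D.isPureEmbedding_evaluation (M i)) ?_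
  obtain ⟨e⟩ := D.symm.exists_dual_dfinsupp_equiv fun i => d (M i)
  refine h.left_summand D (isDirectSummand_of_linearEquiv e.symm)
    (h.dual_mem_of_pureClosure D H ⟨_, _, ?_, isPureEmbedding_dfinsupp fun i => d (M i)⟩)
  exact h.prod_mem _ fun i => (h.mem_iff _).1 (hM i)

theorem definable_left (h : IsAlmostDualPair d S P) (D : DualityPair d d')
    (H : ∀ N, P N → S (d' N)) : IsDefinable S where
  iso _ _ e := h.left_summand D (isDirectSummand_of_linearEquiv e.symm)
  prod _ M hM := h.left_prod D H M hM
  directLimit _ _ _ _ _ G f _ hG := (h.mem_iff _).2 <|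
    h.summand_mem (D.isDirectSummand_dual_directLimit G f)
      (h.prod_mem _ fun i => (h.mem_iff _).1 (hG i))
  pure _ _ _ hf hB := h.left_pure D hf hB

/-- If the duals of the modules in `P` lie in `S`, then membership in `P⁺` is detected by the
dual. -/
theorem pureClosure_iff_dual_mem (h : IsAlmostDualPair d S P) (D : DualityPair d d')
    (H : ∀ N, P N → S (d' N)) (N : ModuleCat.{u} B) : PureClosure P N ↔ S (d' N) :=
  ⟨h.dual_mem_of_pureClosure D H, fun hN =>
    ⟨_, D.symm.evaluation N, (h.mem_iff _).1 hN, D.symm.isPureEmbedding_evaluation N⟩⟩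

theorem definable_right (h : IsAlmostDualPair d S P) (D : DualityPair d d')
    (H : ∀ N, P N → S (d' N)) : IsDefinable (PureClosure P) where
  iso _ _ e hA := by
    obtain ⟨f, hf⟩ := (isDirectSummand_of_linearEquiv e.symm).exists_isPureEmbedding
    exact PureClosure.of_isPureEmbedding hf hA
  prod _ M hM := by
    choose C f hC hf using hM
    exact ⟨_, _, h.prod_mem C hC, IsPureEmbedding.pi hf⟩
  directLimit _ _ _ _ _ G f _ hG := (h.pureClosure_iff_dual_mem D H _).2 <|
    h.left_summand D (D.symm.isDirectSummand_dual_directLimit G f)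
      (h.left_prod D H _ fun i => (h.pureClosure_iff_dual_mem D H _).1 (hG i))
  pure _ _ _ hf hB := PureClosure.of_isPureEmbedding hf hB

/-- If `P⁺` is definable, then it contains the bidual of each of its members, which is
pure-injective and thus even belongs to `P`. -/
theorem dual_mem_of_definable (h : IsAlmostDualPair d S P) (D : DualityPair d d')
    (hP : IsDefinable (PureClosure P)) {N : ModuleCat.{u} B} (hN : PureClosure P N) :
    S (d' N) :=
  (h.mem_iff _).2 (h.mem_of_pureClosure (D.symm.bidual_mem hP hN) (D.isPureInjective_dual _))

/-- Since pure-injective hulls exist, each module in `P⁺` is pure in a pure-injective module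
in `P`. -/
theorem exists_pure_of_pinj_le (h : IsAlmostDualPair d S P) (D : DualityPair d d')
    (hP : Pinj P ≤ ProdClosure (dualClass d S)) {N : ModuleCat.{u} B} (hN : PureClosure P N) :
    ∃ M, S M ∧ ∃ f : N →ₗ[B] d M, IsPureEmbedding f := by
  obtain ⟨C, f, hC, hf⟩ := hN
  obtain ⟨E, j, hj⟩ := exists_isPureInjectiveHull C
  obtain ⟨M, hM, hs⟩ := h.exists_isDirectSummand_of_prodClosure D
    (hP E ⟨h.closedUnderHulls j hj hC, hj.isPureInjective⟩)
  obtain ⟨g, hg⟩ := hs.exists_isPureEmbedding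
  exact ⟨M, hM, g ∘ₗ j ∘ₗ f, hg.comp (hj.isPureEmbedding.comp hf)⟩

theorem isDualPair (h : IsAlmostDualPair d S P) (D : DualityPair d d')
    (H : ∀ N, P N → S (d' N)) : IsDualPair d S P where
  toIsAlmostDualPair := h
  prodClosure_dualClass := by
    refine le_antisymm (prodClosure_le ?_ ?_ ?_) ?_
    · rintro N ⟨M, hM, ⟨e⟩⟩
      have hs := isDirectSummand_of_linearEquiv e
      exact ⟨h.summand_mem hs ((h.mem_iff M).1 hM),
        (D.isPureInjective_dual M).of_isDirectSummand hs⟩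
    · exact fun I M hM => ⟨h.prod_mem M fun i => (hM i).1, IsPureInjective.pi fun i => (hM i).2⟩
    · exact fun hs hN => ⟨h.summand_mem hs hN.1, hN.2.of_isDirectSummand hs⟩
    · rintro N ⟨hN, hi⟩
      exact ProdClosure.summand _ _ (hi.isDirectSummand (D.symm.isPureEmbedding_evaluation N))
        (ProdClosure.of _ ⟨_, H N hN, ⟨LinearEquiv.refl _ _⟩⟩)

end IsAlmostDualPair

/-! ### Dual pairs of definable subcategories -/

section DefinablePairs

variable {A B : Type u} [Ring A] [Ring B] {d : ModuleCat.{u} A → ModuleCat.{u} B}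
  {d' : ModuleCat.{u} B → ModuleCat.{u} A}
  {S : ObjectProperty (ModuleCat.{u} A)} {Q : ObjectProperty (ModuleCat.{u} B)}

/-- Two definable classes each of which consists of the modules whose duals lie in the other form a
dual pair of definable subcategories. The hypotheses are symmetric. -/
theorem isDefinableDualPair_of_mem_iff (D : DualityPair d d') (hS : IsDefinable S)
    (hQ : IsDefinable Q) (hSQ : ∀ M, S M ↔ Q (d M)) (hQS : ∀ N, Q N ↔ S (d' N)) :
    IsDefinableDualPair d d' S Q := by
  have h : IsAlmostDualPair d S Q :=
    { eq_prodClosure := hQ.eq_prodClosure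
      -- A pure-injective hull of `M` is a direct summand of the bidual of `M`.
      closedUnderHulls := fun M H i hi hM => hQ.isDirectSummand
        (hi.isDirectSummand (D.symm.isPureEmbedding_evaluation M) (D.isPureInjective_dual _))
        ((hSQ _).1 ((hQS M).1 hM))
      mem_iff := hSQ }
  refine { h.isDualPair D fun N => (hQS N).1 with
    definable_left := hS
    definable_right := hQ
    right_eq := le_antisymm (fun N hN => ?_) ?_
    left_eq := le_antisymm (fun M hM => ?_) ?_ }
  · exact ⟨_, D.symm.evaluation N, ⟨_, (hQS N).1 hN, ⟨LinearEquiv.refl _ _⟩⟩,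
      D.symm.isPureEmbedding_evaluation N⟩
  · rintro N ⟨_, f, ⟨M, hM, ⟨e⟩⟩, hf⟩
    exact hQ.pure f hf (hQ.iso e.symm ((hSQ M).1 hM))
  · exact ⟨_, D.evaluation M, ⟨_, (hSQ M).1 hM, ⟨LinearEquiv.refl _ _⟩⟩,
      D.isPureEmbedding_evaluation M⟩
  · rintro M ⟨_, f, ⟨N, hN, ⟨e⟩⟩, hf⟩
    exact hS.pure f hf (hS.iso e.symm ((hQS N).1 hN))

/-- A dual pair of definable subcategories may be read in the opposite direction. -/
theorem IsDefinableDualPair.symm (D : DualityPair d d') (h : IsDefinableDualPair d d' S Q) :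
    IsDefinableDualPair d' d Q S := by
  refine isDefinableDualPair_of_mem_iff D.symm h.definable_right h.definable_left (fun N => ?_)
    h.mem_iff
  refine ⟨fun hN => ?_, fun hN => ?_⟩
  · rw [h.left_eq]
    exact le_pureClosure _ _ ⟨N, hN, ⟨LinearEquiv.refl _ _⟩⟩
  · exact h.definable_right.pure _ (D.symm.isPureEmbedding_evaluation N) ((h.mem_iff _).1 hN)

theorem dualClass_le_iff (hS : ∀ {M N : ModuleCat.{u} A}, (M ≃ₗ[A] N) → S N → S M) :
    dualClass d' Q ≤ S ↔ ∀ N, Q N → S (d' N) :=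
  ⟨fun h N hN => h _ ⟨N, hN, ⟨LinearEquiv.refl _ _⟩⟩, fun h _ ⟨N, hN, ⟨e⟩⟩ => hS e (h N hN)⟩

end DefinablePairs

end DualPairs

open DualPairs

theorem theorem4p4 (R : Type u) [Ring R]
    (S : ObjectProperty (ModuleCat.{u} R)) (P : ObjectProperty (ModuleCat.{u} Rᵐᵒᵖ))
    (hSP : IsAlmostDualPair (leftDual R) S P) :
    List.TFAE [
      IsDefinable (PureClosure P),
      dualClass (rightDual R) P ≤ S,
      dualClass (rightDual R) (PureClosure P) ≤ S,
      IsDefinable S ∧ Pinj P ≤ ProdClosure (dualClass (leftDual R) S),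
      IsDefinable S ∧ ∀ N : ModuleCat.{u} Rᵐᵒᵖ, PureClosure P N →
        ∃ M : ModuleCat.{u} R, S M ∧ ∃ f : N →ₗ[Rᵐᵒᵖ] leftDual R M, IsPureEmbedding f,
      IsDefinable S ∧ IsDualPair (leftDual R) S P,
      IsDefinableDualPair (leftDual R) (rightDual R) S (PureClosure P)] ∧
    (IsDefinableDualPair (leftDual R) (rightDual R) S (PureClosure P) →
      IsDefinableDualPair (rightDual R) (leftDual R) (PureClosure P) S) := by
  let D := leftRightDuality R
  refine ⟨?_, fun h => h.symm D⟩
  have hiso : ∀ {M N : ModuleCat.{u} R}, (M ≃ₗ[R] N) → S N → S M := fun e =>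
    hSP.left_summand D (isDirectSummand_of_linearEquiv e)
  rw [dualClass_le_iff hiso, dualClass_le_iff hiso]
  tfae_have 1 → 3 := fun h _ => hSP.dual_mem_of_definable D h
  tfae_have 3 → 2 := fun h N hN => h N (le_pureClosure P N hN)
  tfae_have 2 → 6 := fun h => ⟨hSP.definable_left D h, hSP.isDualPair D h⟩
  tfae_have 6 → 4 := fun ⟨hS, h⟩ => ⟨hS, h.prodClosure_dualClass.ge⟩
  tfae_have 4 → 5 := fun ⟨hS, h⟩ => ⟨hS, fun _ => hSP.exists_pure_of_pinj_le D h⟩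
  tfae_have 5 → 2 := fun ⟨hS, h⟩ N hN =>
    D.dual_mem_of_exists_pure hS (h N (le_pureClosure P N hN))
  tfae_have 2 → 7 := fun h => isDefinableDualPair_of_mem_iff D (hSP.definable_left D h)
    (hSP.definable_right D h)
    (fun M => (hSP.mem_iff M).trans ⟨le_pureClosure P _, fun hM =>
      hSP.mem_of_pureClosure hM (D.isPureInjective_dual M)⟩)
    (hSP.pureClosure_iff_dual_mem D h)
  tfae_have 7 → 1 := fun h => h.definable_right
  tfae_finish
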